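/- A biquandle is a non-empty set $X$ with an invertible map $R=(R_1,R_2)\colon X\times X\to X\times X$ satisfying the Yang–Baxter equation $(R\times\mathrm{id})(\mathrm{id}\times R)(R\times\mathrm{id})=(\mathrm{id}\times R)(R\times\mathrm{id})(\mathrm{id}\times R)$ and such that (a) for all $x,z$ there is a unique $y$ with $R_1(x,y)=z$; (b) for all $y,w$ there is a unique $x$ with $R_2(x,y)=w$; (c) for every $a$ there is a unique $x$ with $R(x,a)=(x,a)$. A virtual biquandle $(X,f,R)$ is a biquandle $(X,R)$ with an automorphism $f$. Its associated biquandle is $(X,VR)$ with $VR(x,y)=(R_1(x,f(y)),R_2(f^{-1}(x),y))$. Draw every crossing of an oriented virtual link diagram with both strands pointing downwards, let $x$ and $y$ be the labels of the left and right incoming semiarcs, and order the outgoing semiarcs from left to right. At a positive crossing the strand from top right to bottom left passes over; at a negative crossing it passes under. A coloring of the diagram by a biquandle $(Y,S)$ labels the semiarcs by elements of $Y$ so that the outgoing labels are $S(x,y)$ at every positive crossing, $S^{-1}(x,y)$ at every negative crossing, and $(y,x)$ at every virtual crossing. A coloring by a virtual biquandle $(X,f,R)$ labels the semiarcs by elements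 of $X$ so that the outgoing labels are $R(x,y)$, $R^{-1}(x,y)$ and $(f^{-1}(y),f(x))$, respectively. (A circle without crossings carries one label.) **Corollary.** Let $(X,f,R)$ be a virtual biquandle with $X$ finite, and let $L$ be an oriented virtual link (in particular, a virtual knot), that is, a class of planar (spherical) oriented virtual link diagrams modulo the generalized Reidemeister moves. Then the number of colorings of $L$ by the virtual biquandle $(X,f,R)$ equals the number of colorings of $L$ by the biquandle $(X,VR)$. Here each number may be computed from any diagram of $L$: if $D$ and $D'$ are diagrams of $L$, then the number of colorings of $D$ by $(X,f,R)$ equals the number of colorings of $D'$ by $(X,VR)$. -/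

import Mathlib

/-!
Biquandles, virtual biquandles, oriented virtual link diagrams on the sphere (as combinatorial
maps of genus zero), virtual links as classes of diagrams under the generalized Reidemeister
moves, and colorings.
-/

namespace VirtualLinks

section Biquandles

/-- `R × id` on `X × X × X`. -/
def onFirst {X : Type*} (R : X × X → X × X) (t : X × X × X) : X × X × X :=
  ((R (t.1, t.2.1)).1, (R (t.1, t.2.1)).2, t.2.2)

/-- `id × R` on `X × X × X`. -/
def onLast {X : Type*} (R : X × X → X × X) (t : X × X × X) : X × X × X :=
  (t.1, R t.2)

/-- A biquandle structure on `X`; the invertibility of `R` is expressed by its being an `Equiv`. -/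
structure Biquandle (X : Type*) where
  nonempty : Nonempty X
  R : X × X ≃ X × X
  yangBaxter : onFirst R ∘ onLast R ∘ onFirst R = onLast R ∘ onFirst R ∘ onLast R
  leftInvertible : ∀ x z : X, ∃! y : X, (R (x, y)).1 = z
  rightInvertible : ∀ y w : X, ∃! x : X, (R (x, y)).2 = w
  typeI : ∀ a : X, ∃! x : X, R (x, a) = (x, a)

/-- A virtual biquandle `(X, f, R)`: a biquandle with an automorphism `f`. -/
structure VirtualBiquandle (X : Type*) extends Biquandle X where
  f : X ≃ X
  map_R : ∀ x y : X, R (f x, f y) = (f (R (x, y)).1, f (R (x, y)).2)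

namespace VirtualBiquandle

variable {X : Type*} (B : VirtualBiquandle X)

/-- The operator `VR (x, y) = (R₁ (x, f y), R₂ (f⁻¹ x, y))`. -/
def VRFun (p : X × X) : X × X :=
  ((B.R (p.1, B.f p.2)).1, (B.R (B.f.symm p.1, p.2)).2)

theorem VRFun_eq (x y : X) :
    B.VRFun (x, y) = (B.f (B.R (B.f.symm x, y)).1, (B.R (B.f.symm x, y)).2) := by
  have h := B.map_R (B.f.symm x) y
  simp only [Equiv.apply_symm_apply] at h
  simp [VRFun, h]

/-- `VR` as an invertible map; its inverse is `(f × id) ∘ R⁻¹ ∘ (f⁻¹ × id)`. -/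
def VR : X × X ≃ X × X where
  toFun := B.VRFun
  invFun p := (B.f (B.R.symm (B.f.symm p.1, p.2)).1, (B.R.symm (B.f.symm p.1, p.2)).2)
  left_inv := by
    rintro ⟨x, y⟩
    rw [VRFun_eq]
    simp
  right_inv := by
    rintro ⟨x, y⟩
    rw [VRFun_eq]
    simp

theorem VR_apply (x y : X) :
    B.VR (x, y) = ((B.R (x, B.f y)).1, (B.R (B.f.symm x, y)).2) := rfl

/-- The biquandle `(X, VR)`. -/
def twist : Biquandle X where
  nonempty := B.nonempty
  R := B.VR
  yangBaxter := by
    funext ⟨x, y, z⟩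
    have e : ∀ x y, B.VR (x, y) = (B.f (B.R (B.f.symm x, y)).1, (B.R (B.f.symm x, y)).2) :=
      B.VRFun_eq
    have h := congrFun B.yangBaxter (B.f.symm (B.f.symm x), B.f.symm y, z)
    have m : ∀ u v, B.R (B.f.symm u, B.f.symm v)
        = (B.f.symm (B.R (u, v)).1, B.f.symm (B.R (u, v)).2) := by
      intro u v
      have := B.map_R (B.f.symm u) (B.f.symm v)
      simp only [Equiv.apply_symm_apply] at this
      rw [this]; simp
    simp only [Function.comp, onFirst, onLast, e, m, Equiv.symm_apply_apply, Prod.mk.injEq]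
      at h ⊢
    have m' : ∀ u v, B.R (u, B.f v)
        = (B.f (B.R (B.f.symm u, v)).1, B.f (B.R (B.f.symm u, v)).2) := by
      intro u v
      have := B.map_R (B.f.symm u) v
      simpa only [Equiv.apply_symm_apply] using this
    simp only [m', Equiv.symm_apply_apply, Equiv.apply_eq_iff_eq]
    exact ⟨h.1, (Prod.ext_iff.1 h.2).1, (Prod.ext_iff.1 h.2).2⟩
  leftInvertible := by
    intro x z
    obtain ⟨y, hy, hu⟩ := B.leftInvertible x z
    refine ⟨B.f.symm y, by simpa [VR_apply] using hy, ?_⟩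
    intro y' hy'
    rw [Equiv.eq_symm_apply]
    exact hu _ hy'
  rightInvertible := by
    intro y w
    obtain ⟨x, hx, hu⟩ := B.rightInvertible y w
    refine ⟨B.f x, by simpa [VR_apply] using hx, ?_⟩
    intro x' hx'
    rw [← Equiv.symm_apply_eq]
    exact hu _ hx'
  typeI := by
    have e : ∀ x y, B.VR (x, y) = (B.f (B.R (B.f.symm x, y)).1, (B.R (B.f.symm x, y)).2) :=
      B.VRFun_eq
    intro a
    obtain ⟨x, hx, hu⟩ := B.typeI a
    refine ⟨B.f x, by simp [e, hx], ?_⟩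
    intro x' hx'
    rw [← Equiv.symm_apply_eq]
    refine hu _ ?_
    rw [e, Prod.mk.injEq, ← Equiv.eq_symm_apply] at hx'
    exact Prod.ext hx'.1 hx'.2

end VirtualBiquandle

end Biquandles

section Diagrams

/-- At a crossing both strands are drawn pointing downwards; the crossing then has a left and a
right incoming end (at the top) and a left and a right outgoing end (at the bottom). One strand
runs from the left incoming end to the right outgoing end, the other one from the right incoming
end to the left outgoing end. -/
inductive Side
  | left
  | right

def Side.other : Side → Side
  | left => right
  | right => left

/-- In a positive crossing the strand from top right to bottom left is the over-strand, in a
negative crossing it is the under-strand. -/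
inductive CrossingKind
  | positive
  | negative
  | virtual

def CrossingKind.mirror : CrossingKind → CrossingKind
  | positive => negative
  | negative => positive
  | virtual => virtual

/-- The outgoing ends (and likewise the incoming ends) of crossings `C` and marked points `M`:
a crossing has a left one and a right one, a marked point has one. -/
abbrev Port (C M : Type) : Type := (C × Side) ⊕ M

/-- The combinatorial data of an oriented virtual link diagram on a closed oriented surface.
Besides the crossings there may be finitely many marked points on the strands, which only
subdivide arcs; in particular a circle without crossings is a circle carrying marked points.
The bijection `next` follows the arc that starts at an outgoing end to the incoming end where it
terminates, so that arcs are identified with the outgoing ends. -/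
structure Diagram where
  C : Type
  M : Type
  finite_C : Finite C
  finite_M : Finite M
  kind : C → CrossingKind
  next : Port C M ≃ Port C M

namespace Diagram

variable (D : Diagram)

/-- The arcs of the diagram, cut at crossings and at marked points. -/
abbrev Arc : Type := Port D.C D.M

/-- The arc that leaves the crossing `c` on the side `s`. -/
def outArc (c : D.C) (s : Side) : D.Arc := Sum.inl (c, s)

/-- The arc that enters the crossing `c` on the side `s`. -/
def inArc (c : D.C) (s : Side) : D.Arc := D.next.symm (Sum.inl (c, s))

/-- The arc that leaves the marked point `m`. -/
def outMark (m : D.M) : D.Arc := Sum.inr m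

/-- The arc that enters the marked point `m`. -/
def inMark (m : D.M) : D.Arc := D.next.symm (Sum.inr m)

/-- `(a, left)` and `(a, right)` are the two sides of the arc `a`, as seen by someone who walks
along `a` in the direction of its orientation. Two sides are adjacent if they bound the same
corner at a crossing (west, south, east, north), or the same side of a marked point. -/
inductive SideAdj : D.Arc × Side → D.Arc × Side → Prop
  | west (c : D.C) : SideAdj (D.inArc c .left, .right) (D.outArc c .left, .right)
  | south (c : D.C) : SideAdj (D.outArc c .left, .left) (D.outArc c .right, .right)
  | east (c : D.C) : SideAdj (D.outArc c .right, .left) (D.inArc c .right, .left)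
  | north (c : D.C) : SideAdj (D.inArc c .right, .right) (D.inArc c .left, .left)
  | mark (m : D.M) (s : Side) : SideAdj (D.inMark m, s) (D.outMark m, s)

/-- The faces of the cellular embedding of the diagram into a closed oriented surface: classes of
sides of arcs under the equivalence relation generated by adjacency. -/
def Face : Type := Quot D.SideAdj

/-- The crossing or marked point at which an end lies. -/
def vertexOf {C M : Type} : Port C M → C ⊕ M := Sum.map Prod.fst id

/-- The connected components of the underlying graph. (This graph is connected when any two
link components are linked by a chain of crossings, so these are not the link components.) -/
def Piece : Type :=
  Quot (fun v w : D.C ⊕ D.M => ∃ a : D.Arc, vertexOf a = v ∧ vertexOf (D.next a) = w)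

/-- Euler's formula: the number of vertices minus the number of arcs plus the number of faces is
twice the number of pieces, that is, every piece is embedded in a sphere. -/
def IsPlanar : Prop :=
  (Nat.card (D.C ⊕ D.M) : ℤ) - Nat.card D.Arc + Nat.card D.Face = 2 * Nat.card D.Piece

/-- `D` and `D'` are isotopic: they agree up to renaming crossings and marked points. -/
def IsIsotopic (D D' : Diagram) : Prop :=
  ∃ (eC : D.C ≃ D'.C) (eM : D.M ≃ D'.M),
    (∀ c, D'.kind (eC c) = D.kind c) ∧
    ∀ a : D.Arc, D'.next (Sum.map (Prod.map eC id) eM a) = Sum.map (Prod.map eC id) eM (D.next a)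

/-- `D'` arises from `D` by putting one new marked point (`none`) on the arc `a₀`. -/
def IsSubdivision (D D' : Diagram) : Prop :=
  ∃ (eC : D.C ≃ D'.C) (eM : Option D.M ≃ D'.M) (a₀ : D.Arc),
    let old : D.Arc → D'.Arc := Sum.map (Prod.map eC id) (fun m => eM (some m))
    (∀ c, D'.kind (eC c) = D.kind c) ∧
    D'.next (old a₀) = Sum.inr (eM none) ∧
    D'.next (Sum.inr (eM none)) = old (D.next a₀) ∧
    ∀ a, a ≠ a₀ → D'.next (old a) = old (D.next a)

end Diagram

end Diagrams

section Moves

/-- The part of a diagram inside a disk that `n` strands enter and leave. `entry i` is the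
incoming end reached first by the `i`-th strand entering the disk, `exit i` is the outgoing end
where the `i`-th strand leaving the disk starts its way out, and `arcs` lists the arcs inside,
from outgoing end to incoming end. -/
structure Tangle (n : ℕ) where
  C : Type
  M : Type
  kind : C → CrossingKind
  entry : Fin n → Port C M
  exit : Fin n → Port C M
  arcs : List (Port C M × Port C M)

/-- The part of a diagram outside a disk that `n` strands enter and leave: `glue` follows the arcs
that start at an outgoing end outside or at an exit of the disk, up to an incoming end outside
or an entry of the disk. -/
structure Outside (n : ℕ) where
  C : Type
  M : Type
  kind : C → CrossingKind
  glue : Port C M ⊕ Fin n ≃ Port C M ⊕ Fin n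

/-- `D` consists of `K` outside of a disk and of `T` inside it. -/
def IsFilling {n : ℕ} (D : Diagram) (K : Outside n) (T : Tangle n) : Prop :=
  ∃ (eC : K.C ⊕ T.C ≃ D.C) (eM : K.M ⊕ T.M ≃ D.M),
    let outer : Port K.C K.M → Port D.C D.M :=
      Sum.map (Prod.map (fun c => eC (Sum.inl c)) id) (fun m => eM (Sum.inl m))
    let inner : Port T.C T.M → Port D.C D.M :=
      Sum.map (Prod.map (fun c => eC (Sum.inr c)) id) (fun m => eM (Sum.inr m))
    (∀ c, D.kind (eC (Sum.inl c)) = K.kind c) ∧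
    (∀ c, D.kind (eC (Sum.inr c)) = T.kind c) ∧
    (∀ a ∈ T.arcs, D.next (inner a.1) = inner a.2) ∧
    ∀ u, D.next (Sum.elim outer (fun i => inner (T.exit i)) u) =
      Sum.elim outer (fun i => inner (T.entry i)) (K.glue u)

/-- The outgoing or incoming end on the side `s` of the `i`-th crossing of a tangle. -/
abbrev pt {k m : ℕ} (i : Fin k) (s : Side) : Port (Fin k) (Fin m) := Sum.inl (i, s)

open Side CrossingKind

/-- `n` strands without crossings, with one marked point on each. -/
def strands (n : ℕ) : Tangle n where
  C := Fin 0
  M := Fin n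
  kind := Fin.elim0
  entry := Sum.inr
  exit := Sum.inr
  arcs := []

/-- One crossing, whose two ends on the side `s` are joined by a loop. -/
def kink (k : CrossingKind) (s : Side) : Tangle 1 where
  C := Fin 1
  M := Fin 0
  kind := ![k]
  entry := ![pt 0 s.other]
  exit := ![pt 0 s.other]
  arcs := [(pt 0 s, pt 0 s)]

/-- Two parallel strands that cross twice. -/
def bigonParallel (k : CrossingKind) : Tangle 2 where
  C := Fin 2
  M := Fin 0
  kind := ![k, k.mirror]
  entry := ![pt 0 left, pt 0 right]
  exit := ![pt 1 left, pt 1 right]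
  arcs := [(pt 0 left, pt 1 left), (pt 0 right, pt 1 right)]

/-- Two antiparallel strands that cross twice; the bigon is on the side `s` of both crossings. -/
def bigonAntiparallel (k : CrossingKind) (s : Side) : Tangle 2 where
  C := Fin 2
  M := Fin 0
  kind := ![k, k.mirror]
  entry := ![pt 0 s.other, pt 1 s.other]
  exit := ![pt 1 s.other, pt 0 s.other]
  arcs := [(pt 0 s, pt 1 s), (pt 1 s, pt 0 s)]

/-- Three parallel strands numbered `1, 2, 3` from left to right at the top. From top to bottom,
strands `1, 2` cross (kind `k₁₂`), then `1, 3`, then `2, 3`. -/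
def triangleA (k₁₂ k₁₃ k₂₃ : CrossingKind) : Tangle 3 where
  C := Fin 3
  M := Fin 0
  kind := ![k₁₂, k₁₃, k₂₃]
  entry := ![pt 0 left, pt 0 right, pt 1 right]
  exit := ![pt 2 left, pt 2 right, pt 1 right]
  arcs := [(pt 0 right, pt 1 left), (pt 0 left, pt 2 left), (pt 1 left, pt 2 right)]

/-- The same three strands, but `2, 3` cross first, then `1, 3`, then `1, 2`. -/
def triangleB (k₁₂ k₁₃ k₂₃ : CrossingKind) : Tangle 3 where
  C := Fin 3
  M := Fin 0
  kind := ![k₂₃, k₁₃, k₁₂]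
  entry := ![pt 1 left, pt 0 left, pt 0 right]
  exit := ![pt 1 left, pt 2 left, pt 2 right]
  arcs := [(pt 0 left, pt 1 right), (pt 1 right, pt 2 left), (pt 0 right, pt 2 right)]

/-- The generalized Reidemeister moves. The first and second moves are listed with all
orientations and signs, classical (`k` positive or negative) and virtual (`k` virtual). The third
moves (classical, virtual, and mixed) are listed for strands that run in parallel, and the
classical one for positive crossings; their versions with other orientations and signs are
compositions of these with second moves. -/
inductive LocalMove : ∀ {n : ℕ}, Tangle n → Tangle n → Prop
  | first (k : CrossingKind) (s : Side) : LocalMove (strands 1) (kink k s)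
  | secondParallel (k : CrossingKind) : LocalMove (strands 2) (bigonParallel k)
  | secondAntiparallel (k : CrossingKind) (s : Side) :
      LocalMove (strands 2) (bigonAntiparallel k s)
  | third :
      LocalMove (triangleA positive positive positive) (triangleB positive positive positive)
  | mixed₁₂ (k : CrossingKind) :
      LocalMove (triangleA k virtual virtual) (triangleB k virtual virtual)
  | mixed₁₃ (k : CrossingKind) :
      LocalMove (triangleA virtual k virtual) (triangleB virtual k virtual)
  | mixed₂₃ (k : CrossingKind) :
      LocalMove (triangleA virtual virtual k) (triangleB virtual virtual k)

/-- An oriented virtual link diagram on the sphere. -/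
abbrev LinkDiagram : Type 1 := {D : Diagram // D.IsPlanar}

/-- One isotopy, one subdivision of an arc by a marked point, or one generalized Reidemeister
move, between diagrams on the sphere. -/
inductive Step : LinkDiagram → LinkDiagram → Prop
  | isotopy (D D' : LinkDiagram) (h : D.1.IsIsotopic D'.1) : Step D D'
  | subdivision (D D' : LinkDiagram) (h : D.1.IsSubdivision D'.1) : Step D D'
  | move (D D' : LinkDiagram) {n : ℕ} (T T' : Tangle n) (h : LocalMove T T') (K : Outside n)
      (hD : IsFilling D.1 K T) (hD' : IsFilling D'.1 K T') : Step D D'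

/-- An oriented virtual link: a class of diagrams under the equivalence relation generated by
the generalized Reidemeister moves. -/
def VirtualLink : Type 1 := Quot Step

/-- `D` is a diagram of the virtual link `L`. -/
def LinkDiagram.Represents (D : LinkDiagram) (L : VirtualLink) : Prop := Quot.mk Step D = L

end Moves

section Colorings

variable {X : Type*}

/-- The labels `(left, right)` of the outgoing arcs of a crossing in terms of those of the
incoming arcs, for labels in a biquandle. -/
def Biquandle.rule (B : Biquandle X) : CrossingKind → X × X → X × X
  | .positive, p => B.R p
  | .negative, p => B.R.symm p
  | .virtual, p => (p.2, p.1)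

/-- The same for labels in a virtual biquandle. -/
def VirtualBiquandle.rule (B : VirtualBiquandle X) : CrossingKind → X × X → X × X
  | .positive, p => B.R p
  | .negative, p => B.R.symm p
  | .virtual, p => (B.f.symm p.2, B.f p.1)

/-- A labeling of the semiarcs of `D` (that is, of the arcs, with equal labels on both sides of
every marked point) that obeys the given rule at all crossings. -/
def Diagram.IsColoring (D : Diagram) (rule : CrossingKind → X × X → X × X) (l : D.Arc → X) :
    Prop :=
  (∀ m : D.M, l (D.outMark m) = l (D.inMark m)) ∧
  ∀ c : D.C, (l (D.outArc c .left), l (D.outArc c .right)) =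
    rule (D.kind c) (l (D.inArc c .left), l (D.inArc c .right))

/-- The colorings of a diagram by a biquandle. -/
def Biquandle.Coloring (B : Biquandle X) (D : LinkDiagram) : Type _ :=
  {l : D.1.Arc → X // D.1.IsColoring B.rule l}

/-- The colorings of a diagram by a virtual biquandle. -/
def VirtualBiquandle.Coloring (B : VirtualBiquandle X) (D : LinkDiagram) : Type _ :=
  {l : D.1.Arc → X // D.1.IsColoring B.rule l}

end Colorings

end VirtualLinks

open VirtualLinks

/-! The operator `VR` is `R` conjugated by `f × id`. A label `x` on an arc `a` can therefore be
replaced by `f ^ h a` applied to `x`, provided the integers `h a` are one larger on the two left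
ends of every crossing than on its two right ends. Since `R` commutes with `f × f`, this turns the
rule of `(X, f, R)` at every classical crossing into that of `VR`. At a virtual crossing the change
of exponent absorbs the twist by `f` and leaves the plain swap. The relabeling is bijective, so on
one diagram the two numbers of colorings agree (`card_coloring_eq_card_twist_coloring`).

Such an `h` is an Alexander numbering: `h a` is the number of the face to the right of `a`, where
the numbers of faces grow by one from left to right across every arc. It exists because the sphere
has no first cohomology. Concretely, jumps of face functions and differences of vertex functions are
orthogonal in `Arc → ℚ`, and by Euler's formula they span it. The constant function `1` is
orthogonal to the latter since every vertex has as many incoming as outgoing arcs, hence it is a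
jump (`IsPlanar.exists_face_numbering`).

To pass to another diagram of the same link, it remains to see that the number of colorings by a
finite biquandle is invariant under moves. A diagram is cut along the circle bounding the move. Both
local pictures allow the same boundary labels, and these determine the labels inside
(`Tangle.Realizes`), so the colorings correspond. Invariance for `(X, f, R)` itself is not needed
separately. -/

namespace VirtualLinks

/-! ### Alexander numberings of diagrams on the sphere -/

section Planarity

/-- A subspace of `A → ℚ` whose elements are determined by their values at the points `q p` has
dimension at most the number of these points. -/
theorem finrank_le_card_of_determined {A P : Type*} [Finite A] [Finite P]
    (W : Submodule ℚ (A → ℚ)) (q : P → A)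
    (h : ∀ u ∈ W, (∀ p, u (q p) = 0) → u = 0) : Module.finrank ℚ W ≤ Nat.card P := by
  classical
  have := Fintype.ofFinite P
  let r : W →ₗ[ℚ] (P → ℚ) := (LinearMap.funLeft ℚ ℚ q).comp W.subtype
  have hr : Function.Injective r := by
    rw [← LinearMap.ker_eq_bot, LinearMap.ker_eq_bot']
    intro u hu
    exact Subtype.ext (h u.1 u.2 fun p => congrFun hu p)
  have := LinearMap.finrank_le_finrank_of_injective hr
  rwa [Module.finrank_fintype_fun_eq_card, ← Nat.card_eq_fintype_card] at this

/-- If the ranges of `f` and `g` are orthogonal and have complementary dimensions, then every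
vector that is orthogonal to the range of `g` lies in the range of `f`. -/
theorem mem_range_of_orthogonal {E U V : Type*} [Fintype E] [AddCommGroup U] [Module ℚ U]
    [AddCommGroup V] [Module ℚ V] (f : U →ₗ[ℚ] (E → ℚ)) (g : V →ₗ[ℚ] (E → ℚ))
    (hfg : ∀ u v, f u ⬝ᵥ g v = 0)
    (hdim : Fintype.card E ≤ Module.finrank ℚ f.range + Module.finrank ℚ g.range)
    (x : E → ℚ) (hx : ∀ v, x ⬝ᵥ g v = 0) : x ∈ f.range := by
  -- A common vector is orthogonal to itself, and the dot product over `ℚ` is definite.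
  have hdisj : f.range ⊓ g.range = ⊥ := by
    rw [eq_bot_iff]
    rintro _ ⟨⟨u, rfl⟩, v, hv⟩
    have := hfg u v
    rw [hv] at this
    exact dotProduct_self_eq_zero.1 this
  have hsup : f.range ⊔ g.range = ⊤ := by
    apply Submodule.eq_top_of_finrank_eq
    have h := Submodule.finrank_sup_add_finrank_inf_eq f.range g.range
    rw [hdisj, finrank_bot, add_zero] at h
    refine le_antisymm (Submodule.finrank_le _) ?_
    rw [h, Module.finrank_fintype_fun_eq_card]
    exact hdim
  obtain ⟨_, ⟨u, rfl⟩, _, ⟨v, rfl⟩, rfl⟩ :=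
    Submodule.mem_sup.1 (hsup ▸ Submodule.mem_top : x ∈ f.range ⊔ g.range)
  -- Pairing with `g v` itself shows that the component of the vector in the range of `g` vanishes.
  have h := hx v
  rw [add_dotProduct, hfg, zero_add] at h
  rw [dotProduct_self_eq_zero.1 h, add_zero]
  exact ⟨u, rfl⟩

namespace Diagram

variable (D : Diagram)

instance : Finite D.C := D.finite_C

instance : Finite D.M := D.finite_M

instance : Finite Side :=
  Finite.of_injective (fun s => match s with | .left => true | .right => false)
    (by rintro (_ | _) (_ | _) h <;> simp_all)

instance : Finite D.Face := inferInstanceAs (Finite (Quot D.SideAdj))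

instance : Finite D.Piece := inferInstanceAs (Finite (Quot _))

/-- The face on the side `s` of the arc `a`. -/
def face (a : D.Arc) (s : Side) : D.Face := Quot.mk _ (a, s)

theorem face_west (c : D.C) : D.face (D.inArc c .left) .right = D.face (D.outArc c .left) .right :=
  Quot.sound (.west c)

theorem face_south (c : D.C) :
    D.face (D.outArc c .left) .left = D.face (D.outArc c .right) .right :=
  Quot.sound (.south c)

theorem face_east (c : D.C) : D.face (D.outArc c .right) .left = D.face (D.inArc c .right) .left :=
  Quot.sound (.east c)

theorem face_north (c : D.C) : D.face (D.inArc c .right) .right = D.face (D.inArc c .left) .left :=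
  Quot.sound (.north c)

theorem face_mark (m : D.M) (s : Side) : D.face (D.inMark m) s = D.face (D.outMark m) s :=
  Quot.sound (.mark m s)

/-- The difference of a function on the faces across the arcs. -/
def faceCoboundary : (D.Face → ℚ) →ₗ[ℚ] (D.Arc → ℚ) :=
  LinearMap.funLeft ℚ ℚ (fun a => D.face a .right) - LinearMap.funLeft ℚ ℚ (fun a => D.face a .left)

/-- The difference of a function on the vertices along the arcs. -/
def vertexCoboundary : (D.C ⊕ D.M → ℚ) →ₗ[ℚ] (D.Arc → ℚ) :=
  LinearMap.funLeft ℚ ℚ vertexOf - LinearMap.funLeft ℚ ℚ (fun a => vertexOf (D.next a))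

theorem faceCoboundary_apply (u : D.Face → ℚ) (a : D.Arc) :
    D.faceCoboundary u a = u (D.face a .right) - u (D.face a .left) := rfl

theorem vertexCoboundary_apply (y : D.C ⊕ D.M → ℚ) (a : D.Arc) :
    D.vertexCoboundary y a = y (vertexOf a) - y (vertexOf (D.next a)) := rfl

/-- An arc that leaves a given vertex. -/
def arcAt : D.C ⊕ D.M → D.Arc
  | .inl c => D.outArc c .left
  | .inr m => D.outMark m

/-- A vertex of a given connected component. -/
noncomputable def Piece.vertex {D : Diagram} (p : D.Piece) : D.C ⊕ D.M := Quot.out p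

/-- A function on the vertices that is constant along arcs is determined by its values at one
vertex of each connected component. -/
theorem apply_eq_of_constant_along_arcs {Z : Type*} (y : D.C ⊕ D.M → Z)
    (hy : ∀ a : D.Arc, y (vertexOf a) = y (vertexOf (D.next a))) (v : D.C ⊕ D.M) :
    ∃ p : D.Piece, y v = y p.vertex := by
  let Y : D.Piece → Z := Quot.lift y (by rintro _ _ ⟨a, rfl, rfl⟩; exact hy a)
  refine ⟨Quot.mk _ v, ?_⟩
  exact (congrArg Y (Quot.out_eq (Quot.mk _ v : D.Piece))).symm

theorem finrank_ker_vertexCoboundary_le :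
    Module.finrank ℚ D.vertexCoboundary.ker ≤ Nat.card D.Piece := by
  refine finrank_le_card_of_determined _ Piece.vertex fun y hy h0 => ?_
  ext v
  obtain ⟨p, hp⟩ := D.apply_eq_of_constant_along_arcs y
    (fun a => sub_eq_zero.1 (congrFun (LinearMap.mem_ker.1 hy) a)) v
  rw [hp, h0, Pi.zero_apply]

/-- An element of the kernel agrees on the two sides of every arc. Turning around a vertex from
corner to corner, it has a single value there; both ends of an arc see this same value, so it is
constant on each component. -/
theorem finrank_ker_faceCoboundary_le :
    Module.finrank ℚ D.faceCoboundary.ker ≤ Nat.card D.Piece := by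
  refine finrank_le_card_of_determined _
    (fun p : D.Piece => D.face (D.arcAt p.vertex) .left) fun u hu h0 => ?_
  have hu' : ∀ a, u (D.face a .right) = u (D.face a .left) :=
    fun a => sub_eq_zero.1 (congrFun (LinearMap.mem_ker.1 hu) a)
  have hout : ∀ a, u (D.face a .left) = u (D.face (D.arcAt (vertexOf a)) .left) := by
    rintro (⟨c, _ | _⟩ | m)
    · rfl
    · exact (hu' _).symm.trans (congrArg u (D.face_south c)).symm
    · rfl
  have hin : ∀ p, u (D.face (D.next.symm p) .left) = u (D.face (D.arcAt (vertexOf p)) .left) := by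
    rintro (⟨c, _ | _⟩ | m)
    · exact (hu' _).symm.trans ((congrArg u (D.face_west c)).trans (hu' _))
    · refine (hu' _).symm.trans ((congrArg u (D.face_north c)).trans ?_)
      exact (hu' _).symm.trans ((congrArg u (D.face_west c)).trans (hu' _))
    · exact congrArg u (D.face_mark m _)
  have hzero : ∀ v, u (D.face (D.arcAt v) .left) = 0 := by
    intro v
    obtain ⟨p, hp⟩ := D.apply_eq_of_constant_along_arcs
      (fun v => u (D.face (D.arcAt v) .left))
      (fun a => by rw [← hout a, ← hin (D.next a), Equiv.symm_apply_apply]) v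
    exact hp.trans (h0 p)
  ext ⟨a, s⟩
  cases s
  · exact (hout a).trans (hzero _)
  · exact (hu' a).trans ((hout a).trans (hzero _))

/-- Summation by parts. -/
theorem dotProduct_vertexCoboundary [Fintype D.Arc] (g : D.Arc → ℚ) (y : D.C ⊕ D.M → ℚ) :
    g ⬝ᵥ D.vertexCoboundary y = ∑ p : D.Arc, (g p - g (D.next.symm p)) * y (vertexOf p) := by
  have h : ∑ a, g a * y (vertexOf (D.next a)) = ∑ p, g (D.next.symm p) * y (vertexOf p) :=
    Fintype.sum_equiv D.next _ _ fun a => by rw [Equiv.symm_apply_apply]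
  simp only [dotProduct, vertexCoboundary_apply, mul_sub, sub_mul, Finset.sum_sub_distrib, h]

/-- The jumps of `u` form a flow: at a crossing the sums over the outgoing and over the incoming
arcs are both `u` at the west corner minus `u` at the east corner. Summation by parts pairs the zero
divergence of this flow with `y`. -/
theorem dotProduct_coboundaries [hArc : Fintype D.Arc] (u : D.Face → ℚ) (y : D.C ⊕ D.M → ℚ) :
    D.faceCoboundary u ⬝ᵥ D.vertexCoboundary y = 0 := by
  classical
  have := Fintype.ofFinite D.C
  have := Fintype.ofFinite D.M
  let : Fintype Side := ⟨{.left, .right}, by rintro (_ | _) <;> simp⟩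
  have hside : ∀ F : Side → ℚ, ∑ s, F s = F .left + F .right := fun F =>
    Finset.sum_pair (by simp)
  -- Only for this instance does the sum over arcs split into crossings and marked points.
  obtain rfl : hArc = instFintypeSum (D.C × Side) D.M := Subsingleton.elim _ _
  rw [dotProduct_vertexCoboundary]
  have hm : ∀ m, D.faceCoboundary u (D.outMark m) = D.faceCoboundary u (D.inMark m) := by
    intro m
    simp only [faceCoboundary_apply, face_mark]
  have hc : ∀ c, D.faceCoboundary u (D.outArc c .left) + D.faceCoboundary u (D.outArc c .right)
      = D.faceCoboundary u (D.inArc c .left) + D.faceCoboundary u (D.inArc c .right) := by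
    intro c
    simp only [faceCoboundary_apply, face_west, face_south, face_east, face_north]
    ring
  rw [Fintype.sum_sum_type, Fintype.sum_prod_type]
  have h1 : ∀ m, (D.faceCoboundary u (.inr m) - D.faceCoboundary u (D.next.symm (.inr m)))
      * y (vertexOf (.inr m)) = 0 := fun m =>
    mul_eq_zero_of_left (sub_eq_zero.2 (hm m)) _
  have h2 : ∀ c, (∑ s, (D.faceCoboundary u (.inl (c, s))
      - D.faceCoboundary u (D.next.symm (.inl (c, s)))) * y (vertexOf (.inl (c, s)))) = 0 := by
    intro c
    rw [hside]
    have := hc c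
    simp only [outArc, inArc] at this
    change _ * y (.inl c) + _ * y (.inl c) = 0
    linear_combination y (.inl c) * this
  simp only [h1, h2, Finset.sum_const_zero, add_zero]

/-- The faces of a diagram on the sphere can be numbered so that the number increases by one
whenever an arc is crossed from left to right. -/
theorem IsPlanar.exists_face_numbering {D : Diagram} (hD : D.IsPlanar) :
    ∃ H : D.Face → ℤ, ∀ a, H (D.face a .right) = H (D.face a .left) + 1 := by
  classical
  have := Fintype.ofFinite D.Arc
  have := Fintype.ofFinite D.Face
  have := Fintype.ofFinite (D.C ⊕ D.M)
  have hmem : (fun _ => 1 : D.Arc → ℚ) ∈ D.faceCoboundary.range := by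
    refine mem_range_of_orthogonal _ D.vertexCoboundary D.dotProduct_coboundaries ?_ _ ?_
    -- The ranks are at least faces minus pieces and vertices minus pieces; by Euler's formula these
    -- bounds add up to the number of arcs.
    · have h1 := D.faceCoboundary.finrank_range_add_finrank_ker
      have h2 := D.vertexCoboundary.finrank_range_add_finrank_ker
      have h3 := D.finrank_ker_faceCoboundary_le
      have h4 := D.finrank_ker_vertexCoboundary_le
      rw [Module.finrank_fintype_fun_eq_card, ← Nat.card_eq_fintype_card] at h1 h2
      rw [← Nat.card_eq_fintype_card]
      unfold IsPlanar at hD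
      omega
    · intro y
      rw [dotProduct_vertexCoboundary]
      simp
  obtain ⟨u, hu⟩ := hmem
  -- The solution is only rational, but its jumps are exactly one, so rounding down preserves them.
  refine ⟨fun F => ⌊u F⌋, fun a => ?_⟩
  have h := congrFun hu a
  rw [faceCoboundary_apply, sub_eq_iff_eq_add'] at h
  simp only [h, Int.floor_add_one]

/-- The arcs of a diagram on the sphere can be numbered so that at every crossing both left ends
have the number of the right ends plus one. -/
theorem IsPlanar.exists_arc_numbering {D : Diagram} (hD : D.IsPlanar) :
    ∃ h : D.Arc → ℤ, (∀ m, h (D.outMark m) = h (D.inMark m)) ∧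
      ∀ c, h (D.outArc c .left) = h (D.inArc c .right) + 1 ∧
        h (D.inArc c .left) = h (D.inArc c .right) + 1 ∧
        h (D.outArc c .right) = h (D.inArc c .right) := by
  obtain ⟨H, hH⟩ := hD.exists_face_numbering
  -- As the strands point downwards, the face to the right of both left ends is west, while it is
  -- north for the incoming and south for the outgoing right end. The two left ends separate west
  -- from north and from south, so north and south are both one below west.
  refine ⟨fun a => H (D.face a .right), fun m => by simp only [face_mark], fun c => ?_⟩
  have h1 := hH (D.inArc c .left)
  have h2 := hH (D.outArc c .left)
  simp only [face_west, ← face_north, face_south] at h1 h2 ⊢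
  omega

end Diagram

end Planarity

/-! ### Relabeling by powers of the automorphism -/

section Comparison

variable {X : Type*} (B : VirtualBiquandle X)

namespace VirtualBiquandle

/-- In the group of permutations of `X × X`, `R` commutes with `f × f`, hence with its integer
powers; the diagonal homomorphism `φ` identifies these with `f ^ n × f ^ n`. -/
theorem zpow_map_R (n : ℤ) (p : X × X) :
    B.R ((B.f ^ n : Equiv.Perm X) p.1, (B.f ^ n : Equiv.Perm X) p.2)
      = ((B.f ^ n : Equiv.Perm X) (B.R p).1, (B.f ^ n : Equiv.Perm X) (B.R p).2) := by
  let φ : Equiv.Perm X →* Equiv.Perm (X × X) :=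
    { toFun := fun g => Equiv.prodCongr g g
      map_one' := rfl
      map_mul' := fun _ _ => rfl }
  have hcomm : Commute (B.R : Equiv.Perm (X × X)) (φ B.f) := Equiv.ext fun p => B.map_R p.1 p.2
  have h := DFunLike.congr_fun (hcomm.zpow_right n) p
  rw [← map_zpow] at h
  exact h

theorem zpow_map_R_symm (n : ℤ) (p : X × X) :
    B.R.symm ((B.f ^ n : Equiv.Perm X) p.1, (B.f ^ n : Equiv.Perm X) p.2)
      = ((B.f ^ n : Equiv.Perm X) (B.R.symm p).1, (B.f ^ n : Equiv.Perm X) (B.R.symm p).2) := by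
  rw [Equiv.symm_apply_eq, zpow_map_R, Equiv.apply_symm_apply]

theorem zpow_add_one_apply (n : ℤ) (x : X) :
    (B.f ^ (n + 1) : Equiv.Perm X) x = B.f ((B.f ^ n : Equiv.Perm X) x) := by
  rw [add_comm, zpow_one_add, Equiv.Perm.mul_apply]

/-- The rules of `(X, f, R)` and of `(X, VR)` are conjugate. -/
theorem twist_rule (k : CrossingKind) (n : ℤ) (p : X × X) :
    B.twist.rule k ((B.f ^ (n + 1) : Equiv.Perm X) p.1, (B.f ^ n : Equiv.Perm X) p.2)
      = ((B.f ^ (n + 1) : Equiv.Perm X) (B.rule k p).1,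
          (B.f ^ n : Equiv.Perm X) (B.rule k p).2) := by
  cases k
  · change B.VRFun _ = _
    rw [VRFun_eq]
    simp only [zpow_add_one_apply, Equiv.symm_apply_apply, zpow_map_R]
    rfl
  · change (B.f (B.R.symm (B.f.symm _, _)).1, (B.R.symm (B.f.symm _, _)).2) = _
    simp only [zpow_add_one_apply, Equiv.symm_apply_apply, zpow_map_R_symm]
    rfl
  · change ((B.f ^ n : Equiv.Perm X) p.2, (B.f ^ (n + 1) : Equiv.Perm X) p.1)
      = ((B.f ^ (n + 1) : Equiv.Perm X) (B.f.symm p.2), (B.f ^ n : Equiv.Perm X) (B.f p.1))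
    rw [zpow_add_one, Equiv.Perm.mul_apply, Equiv.Perm.mul_apply,
      Equiv.apply_symm_apply]

/-- For a diagram on the sphere, the colorings by `(X, f, R)` correspond to those by `(X, VR)`. -/
theorem card_coloring_eq_card_twist_coloring (D : LinkDiagram) :
    Nat.card (B.Coloring D) = Nat.card (B.twist.Coloring D) := by
  obtain ⟨h, hm, hc⟩ := D.2.exists_arc_numbering
  refine Nat.card_congr (Equiv.subtypeEquiv
    (Equiv.piCongrRight fun a => (B.f ^ h a : Equiv.Perm X)) fun l => and_congr ?_ ?_)
  · refine forall_congr' fun m => ?_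
    simp only [Equiv.piCongrRight_apply, Pi.map_apply, hm, EmbeddingLike.apply_eq_iff_eq]
  · refine forall_congr' fun c => ?_
    obtain ⟨h1, h2, h3⟩ := hc c
    simp only [Equiv.piCongrRight_apply, Pi.map_apply, h1, h2, h3]
    -- Here `n` is the number of the right ends. Both sides now carry the same powers of `f`, which
    -- cancel by injectivity.
    rw [B.twist_rule _ _ (l (D.1.inArc c .left), l (D.1.inArc c .right))]
    simp only [Prod.ext_iff, EmbeddingLike.apply_eq_iff_eq]

end VirtualBiquandle

end Comparison

/-! ### Cutting a diagram along a circle, and replacing tangles -/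

section Fillings

variable {X : Type*}

/-- A labeling of the outgoing ends outside a disk, together with labels `o` of the strands that
leave the disk, obeys the rule outside the disk. -/
def Outside.IsColoring {n : ℕ} (K : Outside n) (rule : CrossingKind → X × X → X × X)
    (l : Port K.C K.M → X) (o : Fin n → X) : Prop :=
  (∀ m, l (.inr m) = Sum.elim l o (K.glue.symm (.inl (.inr m)))) ∧
  ∀ c, (l (.inl (c, .left)), l (.inl (c, .right))) =
    rule (K.kind c) (Sum.elim l o (K.glue.symm (.inl (.inl (c, .left)))),
      Sum.elim l o (K.glue.symm (.inl (.inl (c, .right)))))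

/-- The label of the `i`-th strand that enters the disk. -/
def Outside.entryLabel {n : ℕ} (K : Outside n) (l : Port K.C K.M → X) (o : Fin n → X)
    (i : Fin n) : X :=
  Sum.elim l o (K.glue.symm (.inr i))

/-- `m` is a coloring of the tangle `T` with labels `a` at the entries and `b` at the exits. -/
def Tangle.IsColoring {n : ℕ} (T : Tangle n) (rule : CrossingKind → X × X → X × X)
    (a b : Fin n → X) (m : Port T.C T.M → X) : Prop :=
  (∀ i, m (T.exit i) = b i) ∧ ∃ inc : Port T.C T.M → X,
    (∀ i, inc (T.entry i) = a i) ∧ (∀ p ∈ T.arcs, inc p.2 = m p.1) ∧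
    (∀ k, m (.inr k) = inc (.inr k)) ∧
    ∀ c, (m (.inl (c, .left)), m (.inl (c, .right))) =
      rule (T.kind c) (inc (.inl (c, .left)), inc (.inl (c, .right)))

/-- Every incoming end of the tangle is an entry or the end of an arc. -/
def Tangle.IsComplete {n : ℕ} (T : Tangle n) : Prop :=
  ∀ p, (∃ i, T.entry i = p) ∨ ∃ q ∈ T.arcs, q.2 = p

/-- The outgoing ends of a diagram that is cut along a circle. -/
def portEquiv {C M C₁ M₁ C₂ M₂ : Type} (eC : C₁ ⊕ C₂ ≃ C) (eM : M₁ ⊕ M₂ ≃ M) :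
    Port C₁ M₁ ⊕ Port C₂ M₂ ≃ Port C M :=
  (Equiv.sumSumSumComm (C₁ × Side) M₁ (C₂ × Side) M₂).trans
    (Equiv.sumCongr ((Equiv.sumProdDistrib C₁ C₂ Side).symm.trans
      (Equiv.prodCongr eC (Equiv.refl _))) eM)

/-- A coloring of a filling consists of a coloring of the outside and one of the tangle. -/
theorem IsFilling.isColoring_iff {n : ℕ} {D : Diagram} {K : Outside n} {T : Tangle n}
    (hT : T.IsComplete) (h : IsFilling D K T) (rule : CrossingKind → X × X → X × X) :
    ∃ e : Port K.C K.M ⊕ Port T.C T.M ≃ D.Arc, ∀ l : D.Arc → X,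
      D.IsColoring rule l ↔
        K.IsColoring rule (fun p => l (e (.inl p))) (fun i => l (e (.inr (T.exit i)))) ∧
        T.IsColoring rule
          (K.entryLabel (fun p => l (e (.inl p))) (fun i => l (e (.inr (T.exit i)))))
          (fun i => l (e (.inr (T.exit i)))) (fun p => l (e (.inr p))) := by
  obtain ⟨eC, eM, hkK, hkT, harcs, hglue⟩ := h
  refine ⟨portEquiv eC eM, fun l => ?_⟩
  set e := portEquiv eC eM with he
  have houter : ∀ p, Sum.map (Prod.map (fun c => eC (Sum.inl c)) id) (fun m => eM (Sum.inl m)) p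
      = e (.inl p) := by rintro (⟨c, s⟩ | m) <;> rfl
  have hinner : ∀ p, Sum.map (Prod.map (fun c => eC (Sum.inr c)) id) (fun m => eM (Sum.inr m)) p
      = e (.inr p) := by rintro (⟨c, s⟩ | m) <;> rfl
  simp only [hinner] at harcs hglue
  -- Read backwards, `glue` leads from an incoming end outside, or an entry, to the arc of `D` that
  -- arrives there.
  have hprev : ∀ v, l (D.next.symm (Sum.elim (fun p => e (.inl p))
      (fun i => e (.inr (T.entry i))) v)) = Sum.elim (fun p => l (e (.inl p)))
      (fun i => l (e (.inr (T.exit i)))) (K.glue.symm v) := by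
    intro v
    obtain ⟨u, rfl⟩ := K.glue.surjective v
    have hu := hglue u
    simp only [show (Sum.map (Prod.map (fun c => eC (Sum.inl c)) id)
      (fun m => eM (Sum.inl m)) : Port K.C K.M → Port D.C D.M) = fun p => e (.inl p) from
        funext houter] at hu
    rw [Equiv.symm_apply_apply, ← hu, Equiv.symm_apply_apply]
    cases u <;> rfl
  have hprevK : ∀ p, l (D.next.symm (e (.inl p))) = Sum.elim (fun p => l (e (.inl p)))
      (fun i => l (e (.inr (T.exit i)))) (K.glue.symm (.inl p)) := fun p => hprev (.inl p)
  have hprevT : ∀ i, l (D.next.symm (e (.inr (T.entry i)))) = K.entryLabel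
      (fun p => l (e (.inl p))) (fun i => l (e (.inr (T.exit i)))) i := fun i => hprev (.inr i)
  have harcs' : ∀ q ∈ T.arcs, l (D.next.symm (e (.inr q.2))) = l (e (.inr q.1)) := by
    intro q hq
    rw [← harcs q hq, Equiv.symm_apply_apply]
  have hsplit : D.IsColoring rule l ↔
      ((∀ m, l (e (.inl (.inr m))) = l (D.next.symm (e (.inl (.inr m))))) ∧
        (∀ m, l (e (.inr (.inr m))) = l (D.next.symm (e (.inr (.inr m)))))) ∧
      (∀ c, (l (e (.inl (.inl (c, .left)))), l (e (.inl (.inl (c, .right))))) =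
        rule (K.kind c) (l (D.next.symm (e (.inl (.inl (c, .left))))),
          l (D.next.symm (e (.inl (.inl (c, .right))))))) ∧
      (∀ c, (l (e (.inr (.inl (c, .left)))), l (e (.inr (.inl (c, .right))))) =
        rule (T.kind c) (l (D.next.symm (e (.inr (.inl (c, .left))))),
          l (D.next.symm (e (.inr (.inl (c, .right))))))) := by
    unfold Diagram.IsColoring
    rw [eM.surjective.forall, Sum.forall, eC.surjective.forall, Sum.forall]
    simp only [hkK, hkT]
    rfl
  rw [hsplit]
  constructor
  · rintro ⟨⟨hmK, hmT⟩, hcK, hcT⟩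
    refine ⟨⟨fun m => ?_, fun c => ?_⟩, fun i => rfl,
      fun p => l (D.next.symm (e (.inr p))), hprevT, harcs', hmT, hcT⟩
    · rw [← hprevK]; exact hmK m
    · rw [← hprevK, ← hprevK]; exact hcK c
  · rintro ⟨⟨hmK, hcK⟩, -, inc, hentry, harc, hmT, hcT⟩
    -- Completeness enters here: it leaves no incoming end of the tangle whose label could be chosen
    -- freely.
    have hinc : ∀ p, inc p = l (D.next.symm (e (.inr p))) := by
      intro p
      rcases hT p with ⟨i, rfl⟩ | ⟨q, hq, rfl⟩
      · rw [hentry, hprevT]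
      · rw [harc q hq, harcs' q hq]
    simp only [hinc] at hmT hcT
    refine ⟨⟨fun m => ?_, hmT⟩, fun c => ?_, hcT⟩
    · rw [hprevK]; exact hmK m
    · rw [hprevK, hprevK]; exact hcK c

/-- The colorings of a filling in terms of those of the outside and of the tangle. -/
theorem IsFilling.nonempty_coloring_equiv {n : ℕ} {D : Diagram} {K : Outside n} {T : Tangle n}
    (hT : T.IsComplete) (h : IsFilling D K T) (rule : CrossingKind → X × X → X × X) :
    Nonempty ({l : D.Arc → X // D.IsColoring rule l} ≃
      Σ x : {x : (Port K.C K.M → X) × (Fin n → X) // K.IsColoring rule x.1 x.2},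
        {m // T.IsColoring rule (K.entryLabel x.1.1 x.1.2) x.1.2 m}) := by
  obtain ⟨e, he⟩ := h.isColoring_iff hT rule
  let P (q : (Port K.C K.M → X) × (Port T.C T.M → X)) : Prop :=
    K.IsColoring rule q.1 (fun i => q.2 (T.exit i)) ∧
      T.IsColoring rule (K.entryLabel q.1 (fun i => q.2 (T.exit i))) (fun i => q.2 (T.exit i)) q.2
  have e₁ : {l : D.Arc → X // D.IsColoring rule l} ≃ {q // P q} :=
    Equiv.subtypeEquiv ((Equiv.arrowCongr e.symm (Equiv.refl X)).trans
      (Equiv.sumArrowEquivProdArrow _ _ _)) he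
  refine ⟨e₁.trans
    { toFun := fun q => ⟨⟨(q.1.1, fun i => q.1.2 (T.exit i)), q.2.1⟩, ⟨q.1.2, q.2.2⟩⟩
      invFun := fun y => ⟨(y.1.1.1, y.2.1), ?_⟩
      left_inv := fun q => rfl
      right_inv := ?_ }⟩
  · obtain ⟨⟨⟨l, o⟩, hl⟩, m, hm⟩ := y
    -- The exit labels `o` are already determined by the coloring of the tangle.
    obtain rfl : (fun i => m (T.exit i)) = o := funext hm.1
    exact ⟨hl, hm⟩
  · rintro ⟨⟨⟨l, o⟩, hl⟩, m, hm⟩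
    obtain rfl : (fun i => m (T.exit i)) = o := funext hm.1
    rfl

/-- The labels at the entries and exits of a tangle that belong to a coloring are those related
by `r`, and they determine the coloring. -/
structure Tangle.Realizes {n : ℕ} (T : Tangle n) (rule : CrossingKind → X × X → X × X)
    (r : (Fin n → X) → (Fin n → X) → Prop) : Prop where
  complete : T.IsComplete
  unique : ∀ a b m m', T.IsColoring rule a b m → T.IsColoring rule a b m' → m = m'
  rel : ∀ a b m, T.IsColoring rule a b m → r a b
  exists_coloring : ∀ a b, r a b → ∃ m, T.IsColoring rule a b m

/-- Each side has at most one element, and the common relation `r` decides for both whether there is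
one. -/
theorem Tangle.Realizes.nonempty_equiv {n : ℕ} {T T' : Tangle n}
    {rule : CrossingKind → X × X → X × X} {r : (Fin n → X) → (Fin n → X) → Prop}
    (h : T.Realizes rule r) (h' : T'.Realizes rule r) (a b : Fin n → X) :
    Nonempty ({m // T.IsColoring rule a b m} ≃ {m // T'.IsColoring rule a b m}) := by
  have s : Subsingleton {m // T.IsColoring rule a b m} :=
    ⟨fun x y => Subtype.ext (h.unique a b _ _ x.2 y.2)⟩
  have s' : Subsingleton {m // T'.IsColoring rule a b m} :=
    ⟨fun x y => Subtype.ext (h'.unique a b _ _ x.2 y.2)⟩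
  refine ⟨equivOfSubsingletonOfSubsingleton (fun x => ?_) (fun x => ?_)⟩
  · have := h'.exists_coloring a b (h.rel a b x.1 x.2)
    exact ⟨this.choose, this.choose_spec⟩
  · have := h.exists_coloring a b (h'.rel a b x.1 x.2)
    exact ⟨this.choose, this.choose_spec⟩

/-- Tangles that realize the same relation may be exchanged. -/
theorem Tangle.Realizes.card_coloring_eq {n : ℕ} {T T' : Tangle n}
    {rule : CrossingKind → X × X → X × X} {r : (Fin n → X) → (Fin n → X) → Prop}
    (h : T.Realizes rule r) (h' : T'.Realizes rule r) {D D' : Diagram} {K : Outside n}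
    (hD : IsFilling D K T) (hD' : IsFilling D' K T') :
    Nat.card {l : D.Arc → X // D.IsColoring rule l} =
      Nat.card {l : D'.Arc → X // D'.IsColoring rule l} := by
  obtain ⟨e⟩ := hD.nonempty_coloring_equiv h.complete rule
  obtain ⟨e'⟩ := hD'.nonempty_coloring_equiv h'.complete rule
  exact Nat.card_congr (e.trans ((Equiv.sigmaCongrRight fun
    x : {x : (Port K.C K.M → X) × (Fin n → X) // K.IsColoring rule x.1 x.2} =>
    (h.nonempty_equiv h' (K.entryLabel x.1.1 x.1.2) x.1.2).some).trans e'.symm))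

theorem Diagram.IsIsotopic.card_coloring_eq {D D' : Diagram} (h : D.IsIsotopic D')
    (rule : CrossingKind → X × X → X × X) :
    Nat.card {l : D.Arc → X // D.IsColoring rule l} =
      Nat.card {l : D'.Arc → X // D'.IsColoring rule l} := by
  obtain ⟨eC, eM, hk, hn⟩ := h
  let e : D.Arc ≃ D'.Arc := Equiv.sumCongr (Equiv.prodCongr eC (Equiv.refl Side)) eM
  have hn' : ∀ a, D'.next (e a) = e (D.next a) := hn
  have hp : ∀ p, D'.next.symm (e p) = e (D.next.symm p) := by
    intro p
    rw [Equiv.symm_apply_eq, hn', Equiv.apply_symm_apply]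
  refine (Nat.card_congr (Equiv.subtypeEquiv (Equiv.arrowCongr e.symm (Equiv.refl X))
    fun l => ?_)).symm
  refine and_congr ?_ ?_
  · rw [eM.surjective.forall]
    refine forall_congr' fun m => ?_
    have := hp (.inr m)
    change l (e (.inr m)) = l (D'.next.symm (e (.inr m))) ↔ _
    rw [hp]
    rfl
  · rw [eC.surjective.forall]
    refine forall_congr' fun c => ?_
    rw [hk]
    change (l (e (.inl (c, .left))), l (e (.inl (c, .right)))) = rule _
      (l (D'.next.symm (e (.inl (c, .left)))), l (D'.next.symm (e (.inl (c, .right))))) ↔ _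
    rw [hp, hp]
    rfl

theorem Diagram.IsSubdivision.card_coloring_eq {D D' : Diagram} (h : D.IsSubdivision D')
    (rule : CrossingKind → X × X → X × X) :
    Nat.card {l : D.Arc → X // D.IsColoring rule l} =
      Nat.card {l : D'.Arc → X // D'.IsColoring rule l} := by
  classical
  obtain ⟨eC, eM, a₀, hk, h₀, h₁, h₂⟩ := h
  let e : Option D.Arc ≃ D'.Arc :=
    { toFun := fun
        | none => .inr (eM none)
        | some a => Sum.map (Prod.map eC id) (fun m => eM (some m)) a
      invFun := fun
        | .inl (c, s) => some (.inl (eC.symm c, s))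
        | .inr m => (eM.symm m).map .inr
      left_inv := by rintro (_ | ⟨c, s⟩ | m) <;> simp
      right_inv := by
        rintro (⟨c, s⟩ | m)
        · simp
        · obtain ⟨m, rfl⟩ := eM.surjective m
          cases m <;> simp }
  have h₀' : D'.next.symm (e none) = e (some a₀) := (Equiv.symm_apply_eq _).2 h₀.symm
  have h₁' : D'.next.symm (e (some (D.next a₀))) = e none := (Equiv.symm_apply_eq _).2 h₁.symm
  have h₂' : ∀ p, p ≠ D.next a₀ → D'.next.symm (e (some p)) = e (some (D.next.symm p)) := by
    intro p hp
    rw [Equiv.symm_apply_eq]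
    have := h₂ (D.next.symm p) (fun h => hp (by rw [← h, Equiv.apply_symm_apply]))
    rw [Equiv.apply_symm_apply] at this
    exact this.symm
  -- Only the end of `a₀` gets a new predecessor, the arc `none`, and that one carries the same
  -- label.
  have hprev : ∀ l : D'.Arc → X, l (e none) = l (e (some a₀)) →
      ∀ p, l (D'.next.symm (e (some p))) = l (e (some (D.next.symm p))) := by
    intro l hl p
    by_cases hp : p = D.next a₀
    · rw [hp, h₁', hl, Equiv.symm_apply_apply]
    · rw [h₂' p hp]
  have hiff : ∀ l : D'.Arc → X, D'.IsColoring rule l ↔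
      l (e none) = l (e (some a₀)) ∧ D.IsColoring rule (fun a => l (e (some a))) := by
    intro l
    have hsplit : D'.IsColoring rule l ↔ (l (e none) = l (D'.next.symm (e none)) ∧
        ∀ m, l (e (some (.inr m))) = l (D'.next.symm (e (some (.inr m))))) ∧
        ∀ c, (l (e (some (.inl (c, .left)))), l (e (some (.inl (c, .right))))) =
          rule (D.kind c) (l (D'.next.symm (e (some (.inl (c, .left))))),
            l (D'.next.symm (e (some (.inl (c, .right)))))) := by
      unfold Diagram.IsColoring
      rw [eM.surjective.forall, Option.forall, eC.surjective.forall]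
      simp only [hk]
      rfl
    rw [hsplit, h₀', and_assoc]
    refine and_congr_right fun hl => ?_
    simp only [hprev l hl]
    rfl
  refine Nat.card_congr
    -- The default value gives the new arc behind the marked point the label of `a₀`.
    { toFun := fun l => ⟨fun a => l.1 (e.symm a |>.getD a₀), ?_⟩
      invFun := fun l => ⟨fun a => l.1 (e (some a)), ((hiff l.1).1 l.2).2⟩
      left_inv := fun l => Subtype.ext (funext fun a => by simp)
      right_inv := fun l => Subtype.ext (funext fun a => ?_) }
  · rw [hiff]
    simp only [Equiv.symm_apply_apply, Option.getD_none, Option.getD_some, true_and]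
    exact l.2
  · obtain ⟨a, rfl⟩ := e.surjective a
    cases a
    · simpa using ((hiff l.1).1 l.2).1.symm
    · simp

end Fillings

/-! ### Invertibility properties of the crossing rules -/

section Rules

variable {X : Type*}

namespace Biquandle

variable (B : Biquandle X)

/-- Allows the second crossing of a bigon to be read backwards, with the rule of the first one. -/
theorem rule_mirror (k : CrossingKind) (p q : X × X) :
    q = B.rule k.mirror p ↔ p = B.rule k q := by
  cases k
  · exact (Equiv.eq_symm_apply _).trans eq_comm
  · exact eq_comm.trans (Equiv.eq_symm_apply _).symm
  · obtain ⟨x, y⟩ := p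
    obtain ⟨z, w⟩ := q
    simp only [rule, CrossingKind.mirror, Prod.mk.injEq]
    tauto

/-- The axiom for `R` passes to the inverse: if `R (z, w) = (x, y)`, then `z` and `x` determine `w`
by the axiom, and thus `y`. -/
theorem rule_leftInvertible (k : CrossingKind) (x z : X) : ∃! y, (B.rule k (x, y)).1 = z := by
  cases k
  · exact B.leftInvertible x z
  · obtain ⟨w, hw, hu⟩ := B.leftInvertible z x
    have key : ∀ y, (B.R.symm (x, y)).1 = z ↔ y = (B.R (z, w)).2 := by
      intro y
      constructor
      · intro h
        have h' : B.R (z, (B.R.symm (x, y)).2) = (x, y) := by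
          rw [← h]
          exact B.R.apply_symm_apply _
        rw [← hu _ (congrArg Prod.fst h'), h']
      · rintro rfl
        rw [show (x, (B.R (z, w)).2) = B.R (z, w) from Prod.ext hw.symm rfl,
          Equiv.symm_apply_apply]
    exact ⟨_, (key _).2 rfl, fun y hy => (key y).1 hy⟩
  · exact ⟨z, rfl, fun _ h => h⟩

theorem rule_rightInvertible (k : CrossingKind) (y w : X) : ∃! x, (B.rule k (x, y)).2 = w := by
  cases k
  · exact B.rightInvertible y w
  · obtain ⟨z, hz, hu⟩ := B.rightInvertible w y
    have key : ∀ x, (B.R.symm (x, y)).2 = w ↔ x = (B.R (z, w)).1 := by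
      intro x
      constructor
      · intro h
        have h' : B.R ((B.R.symm (x, y)).1, w) = (x, y) := by
          rw [← h]
          exact B.R.apply_symm_apply _
        rw [← hu _ (congrArg Prod.snd h'), h']
      · rintro rfl
        rw [show ((B.R (z, w)).1, y) = B.R (z, w) from Prod.ext rfl hz.symm,
          Equiv.symm_apply_apply]
    exact ⟨_, (key _).2 rfl, fun x hx => (key x).1 hx⟩
  · exact ⟨w, rfl, fun _ h => h⟩

/-- The third axiom only gives a function `σ`, which handles a kink from one side. Left
invertibility makes `σ` injective, and finiteness makes it bijective, as kinks on both sides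
require. The inverse of `R` has the same fixed pairs; for the swap these are the diagonal. -/
theorem exists_fixed_equiv [Finite X] (k : CrossingKind) :
    ∃ σ : X ≃ X, ∀ x a, B.rule k (x, a) = (x, a) ↔ x = σ a := by
  choose σ hσ hu using B.typeI
  have hinj : Function.Injective σ := fun a a' h =>
    (B.leftInvertible (σ a) (σ a)).unique (congrArg Prod.fst (hσ a))
      (by rw [h]; exact congrArg Prod.fst (hσ a'))
  have hpos : ∀ x a, B.R (x, a) = (x, a) ↔ x = σ a := fun x a =>
    ⟨hu a x, by rintro rfl; exact hσ a⟩
  cases k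
  · exact ⟨Equiv.ofBijective σ (Finite.injective_iff_bijective.1 hinj), hpos⟩
  · refine ⟨Equiv.ofBijective σ (Finite.injective_iff_bijective.1 hinj), fun x a => ?_⟩
    exact ((Equiv.symm_apply_eq _).trans eq_comm).trans (hpos x a)
  · refine ⟨Equiv.refl X, fun x a => ?_⟩
    simp only [rule, Prod.mk.injEq, Equiv.refl_apply]
    tauto

/-- The loop of a kink on the right-hand side. -/
theorem exists_loop_right [Finite X] (k : CrossingKind) (x : X) :
    ∃ t, ∀ y t', (y, t') = B.rule k (x, t') ↔ y = x ∧ t' = t := by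
  obtain ⟨σ, hσ⟩ := B.exists_fixed_equiv k
  refine ⟨σ.symm x, fun y t => ⟨fun h => ?_, ?_⟩⟩
  -- Equality of the right labels alone forces the pair to be the fixed one, and then the left
  -- labels agree as well.
  · have hx : x = σ t := (B.rule_rightInvertible k t t).unique (congrArg Prod.snd h).symm
      (congrArg Prod.snd ((hσ _ t).2 rfl))
    refine ⟨?_, by rw [hx, Equiv.symm_apply_apply]⟩
    rw [(hσ x t).2 hx] at h
    exact congrArg Prod.fst h
  · rintro ⟨rfl, rfl⟩
    exact ((hσ _ _).2 (Equiv.apply_symm_apply _ _).symm).symm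

/-- The loop of a kink on the left-hand side. -/
theorem exists_loop_left [Finite X] (k : CrossingKind) (x : X) :
    ∃ t, ∀ y t', (t', y) = B.rule k (t', x) ↔ y = x ∧ t' = t := by
  obtain ⟨σ, hσ⟩ := B.exists_fixed_equiv k
  refine ⟨σ x, fun y t => ⟨fun h => ?_, ?_⟩⟩
  · have hx : x = σ.symm t := (B.rule_leftInvertible k t t).unique (congrArg Prod.fst h).symm
      (congrArg Prod.fst ((hσ t _).2 (Equiv.apply_symm_apply _ _).symm))
    have ht : t = σ x := by rw [hx, Equiv.apply_symm_apply]
    refine ⟨?_, ht⟩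
    rw [(hσ t x).2 ht] at h
    exact congrArg Prod.snd h
  · rintro ⟨rfl, rfl⟩
    exact ((hσ _ _).2 rfl).symm

end Biquandle

/-- A labeling of the ends of finitely many crossings by the pairs of labels at each crossing. -/
def portLabels {n : ℕ} (P : Fin n → X × X) : Port (Fin n) (Fin 0) → X
  | .inl (i, .left) => (P i).1
  | .inl (i, .right) => (P i).2
  | .inr j => j.elim0

theorem port_forall {n : ℕ} {Q : Port (Fin n) (Fin 0) → Prop} :
    (∀ p, Q p) ↔ ∀ i, Q (pt i .left) ∧ Q (pt i .right) := by
  refine ⟨fun h i => ⟨h _, h _⟩, ?_⟩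
  rintro h (⟨i, _ | _⟩ | j)
  · exact (h i).1
  · exact (h i).2
  · exact j.elim0

end Rules

/-! ### Invariance under the generalized Reidemeister moves -/

section LocalMoves

variable {X : Type*} (B : Biquandle X)

open Side CrossingKind

theorem strands_realizes (rule : CrossingKind → X × X → X × X) (n : ℕ) :
    (strands n).Realizes rule Eq where
  complete := by
    rintro (⟨c, s⟩ | i)
    · exact c.elim0
    · exact Or.inl ⟨i, rfl⟩
  unique := by
    rintro a b m m' ⟨h, -⟩ ⟨h', -⟩
    funext p
    rcases p with ⟨c, s⟩ | i
    · exact c.elim0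
    · exact (h i).trans (h' i).symm
  rel := by
    rintro a b m ⟨h, inc, ha, -, hm, -⟩
    funext i
    rw [← h i, ← ha i]
    exact (hm i).symm
  exists_coloring := by
    rintro a _ rfl
    refine ⟨Sum.elim (fun c => c.1.elim0) a, fun i => rfl, Sum.elim (fun c => c.1.elim0) a,
      fun i => rfl, ?_, fun i => rfl, fun c => c.elim0⟩
    exact fun p hp => (List.not_mem_nil hp).elim

/-- Eliminates the auxiliary incoming labels: what remains is one equation in which the loop label
occurs as input and as output. -/
theorem kink_right_isColoring_iff (rule : CrossingKind → X × X → X × X) (k : CrossingKind)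
    (a b : Fin 1 → X) (m : Port (Fin 1) (Fin 0) → X) :
    (kink k right).IsColoring rule a b m ↔ m (pt 0 left) = b 0 ∧
      (b 0, m (pt 0 right)) = rule k (a 0, m (pt 0 right)) := by
  constructor
  · rintro ⟨hb, inc, ha, harc, -, hc⟩
    have hb0 : m (pt 0 left) = b 0 := hb 0
    have ha0 : inc (pt 0 left) = a 0 := ha 0
    have ht : inc (pt 0 right) = m (pt 0 right) := harc _ (List.mem_singleton.2 rfl)
    have h : (m (pt 0 left), m (pt 0 right)) = rule k (inc (pt 0 left), inc (pt 0 right)) := hc (0 : Fin 1)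
    rw [hb0, ha0, ht] at h
    exact ⟨hb0, h⟩
  · rintro ⟨hb, h⟩
    refine ⟨Fin.forall_fin_one.2 hb, portLabels ![(a 0, m (pt 0 right))],
      Fin.forall_fin_one.2 rfl, ?_, fun j => j.elim0, Fin.forall_fin_one.2 ?_⟩
    · intro p hp
      rw [List.mem_singleton.1 hp]
      rfl
    · exact (congrArg (·, m (pt 0 right)) hb).trans h

theorem kink_left_isColoring_iff (rule : CrossingKind → X × X → X × X) (k : CrossingKind)
    (a b : Fin 1 → X) (m : Port (Fin 1) (Fin 0) → X) :
    (kink k left).IsColoring rule a b m ↔ m (pt 0 right) = b 0 ∧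
      (m (pt 0 left), b 0) = rule k (m (pt 0 left), a 0) := by
  constructor
  · rintro ⟨hb, inc, ha, harc, -, hc⟩
    have hb0 : m (pt 0 right) = b 0 := hb 0
    have ha0 : inc (pt 0 right) = a 0 := ha 0
    have ht : inc (pt 0 left) = m (pt 0 left) := harc _ (List.mem_singleton.2 rfl)
    have h : (m (pt 0 left), m (pt 0 right)) = rule k (inc (pt 0 left), inc (pt 0 right)) := hc (0 : Fin 1)
    rw [hb0, ha0, ht] at h
    exact ⟨hb0, h⟩
  · rintro ⟨hb, h⟩
    refine ⟨Fin.forall_fin_one.2 hb, portLabels ![(m (pt 0 left), a 0)],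
      Fin.forall_fin_one.2 rfl, ?_, fun j => j.elim0, Fin.forall_fin_one.2 ?_⟩
    · intro p hp
      rw [List.mem_singleton.1 hp]
      rfl
    · exact (congrArg (m (pt 0 left), ·) hb).trans h

theorem kink_realizes [Finite X] (k : CrossingKind) (s : Side) :
    (kink k s).Realizes B.rule Eq := by
  cases s
  · refine ⟨?_, ?_, ?_, ?_⟩
    · exact port_forall.2 (Fin.forall_fin_one.2
        ⟨Or.inr ⟨_, List.mem_singleton.2 rfl, rfl⟩, Or.inl ⟨0, rfl⟩⟩)
    · intro a b m m' h h'
      replace h := (kink_left_isColoring_iff ..).1 h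
      replace h' := (kink_left_isColoring_iff ..).1 h'
      obtain ⟨t, ht⟩ := B.exists_loop_left k (a 0)
      exact funext (port_forall.2 (Fin.forall_fin_one.2
        ⟨((ht _ _).1 h.2).2.trans ((ht _ _).1 h'.2).2.symm, h.1.trans h'.1.symm⟩))
    · intro a b m h
      replace h := (kink_left_isColoring_iff ..).1 h
      obtain ⟨t, ht⟩ := B.exists_loop_left k (a 0)
      exact funext (Fin.forall_fin_one.2 ((ht _ _).1 h.2).1.symm)
    · rintro a _ rfl
      obtain ⟨t, ht⟩ := B.exists_loop_left k (a 0)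
      exact ⟨portLabels ![(t, a 0)],
        (kink_left_isColoring_iff _ _ _ _ _).2 ⟨rfl, (ht _ _).2 ⟨rfl, rfl⟩⟩⟩
  · refine ⟨?_, ?_, ?_, ?_⟩
    · exact port_forall.2 (Fin.forall_fin_one.2
        ⟨Or.inl ⟨0, rfl⟩, Or.inr ⟨_, List.mem_singleton.2 rfl, rfl⟩⟩)
    · intro a b m m' h h'
      replace h := (kink_right_isColoring_iff ..).1 h
      replace h' := (kink_right_isColoring_iff ..).1 h'
      obtain ⟨t, ht⟩ := B.exists_loop_right k (a 0)
      exact funext (port_forall.2 (Fin.forall_fin_one.2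
        ⟨h.1.trans h'.1.symm, ((ht _ _).1 h.2).2.trans ((ht _ _).1 h'.2).2.symm⟩))
    · intro a b m h
      replace h := (kink_right_isColoring_iff ..).1 h
      obtain ⟨t, ht⟩ := B.exists_loop_right k (a 0)
      exact funext (Fin.forall_fin_one.2 ((ht _ _).1 h.2).1.symm)
    · rintro a _ rfl
      obtain ⟨t, ht⟩ := B.exists_loop_right k (a 0)
      exact ⟨portLabels ![(a 0, t)],
        (kink_right_isColoring_iff _ _ _ _ _).2 ⟨rfl, (ht _ _).2 ⟨rfl, rfl⟩⟩⟩

theorem bigonParallel_isColoring_iff (k : CrossingKind) (a b : Fin 2 → X)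
    (m : Port (Fin 2) (Fin 0) → X) :
    (bigonParallel k).IsColoring B.rule a b m ↔
      (m (pt 1 left) = b 0 ∧ m (pt 1 right) = b 1) ∧
      (m (pt 0 left), m (pt 0 right)) = B.rule k (a 0, a 1) ∧
      (b 0, b 1) = B.rule k.mirror (m (pt 0 left), m (pt 0 right)) := by
  constructor
  · rintro ⟨hb, inc, ha, harc, -, hc⟩
    have hb0 : m (pt 1 left) = b 0 := hb 0
    have hb1 : m (pt 1 right) = b 1 := hb 1
    have ha0 : inc (pt 0 left) = a 0 := ha 0
    have ha1 : inc (pt 0 right) = a 1 := ha 1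
    have h1 : inc (pt 1 left) = m (pt 0 left) :=
      harc _ List.mem_cons_self
    have h2 : inc (pt 1 right) = m (pt 0 right) :=
      harc _ (List.mem_cons_of_mem _ List.mem_cons_self)
    have hc0 : (m (pt 0 left), m (pt 0 right)) = B.rule k (inc (pt 0 left), inc (pt 0 right)) :=
      hc (0 : Fin 2)
    have hc1 : (m (pt 1 left), m (pt 1 right)) =
      B.rule k.mirror (inc (pt 1 left), inc (pt 1 right)) := hc (1 : Fin 2)
    rw [ha0, ha1] at hc0
    rw [hb0, hb1, h1, h2] at hc1
    exact ⟨⟨hb0, hb1⟩, hc0, hc1⟩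
  · rintro ⟨⟨hb0, hb1⟩, hc0, hc1⟩
    refine ⟨Fin.forall_fin_two.2 ⟨hb0, hb1⟩,
      portLabels ![(a 0, a 1), (m (pt 0 left), m (pt 0 right))],
      Fin.forall_fin_two.2 ⟨rfl, rfl⟩, ?_, fun j => j.elim0, Fin.forall_fin_two.2 ⟨hc0, ?_⟩⟩
    · exact List.forall_mem_cons.2 ⟨rfl, List.forall_mem_singleton.2 rfl⟩
    · exact (congrArg₂ Prod.mk hb0 hb1).trans hc1

/-- The rule of the second crossing is inverse to that of the first. -/
theorem bigonParallel_realizes (k : CrossingKind) : (bigonParallel k).Realizes B.rule Eq where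
  complete := port_forall.2 (Fin.forall_fin_two.2
    ⟨⟨Or.inl ⟨0, rfl⟩, Or.inl ⟨1, rfl⟩⟩,
      Or.inr ⟨_, List.mem_cons_self, rfl⟩,
      Or.inr ⟨_, List.mem_cons_of_mem _ List.mem_cons_self, rfl⟩⟩)
  unique := by
    intro a b m m' h h'
    replace h := (bigonParallel_isColoring_iff ..).1 h
    replace h' := (bigonParallel_isColoring_iff ..).1 h'
    obtain ⟨⟨h1, h2⟩, h3, -⟩ := h
    obtain ⟨⟨h1', h2'⟩, h3', -⟩ := h'
    have h4 := h3.trans h3'.symm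
    exact funext (port_forall.2 (Fin.forall_fin_two.2
      ⟨⟨congrArg Prod.fst h4, congrArg Prod.snd h4⟩, h1.trans h1'.symm, h2.trans h2'.symm⟩))
  rel := by
    intro a b m h
    replace h := (bigonParallel_isColoring_iff ..).1 h
    obtain ⟨-, h3, h4⟩ := h
    have h5 := h4.trans ((B.rule_mirror k _ _).2 h3).symm
    exact (funext (Fin.forall_fin_two.2 ⟨congrArg Prod.fst h5, congrArg Prod.snd h5⟩)).symm
  exists_coloring := by
    rintro a _ rfl
    exact ⟨portLabels ![B.rule k (a 0, a 1), (a 0, a 1)],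
      (bigonParallel_isColoring_iff B _ _ _ _).2
        ⟨⟨rfl, rfl⟩, rfl, (B.rule_mirror k _ _).2 rfl⟩⟩

theorem bigonAntiparallel_left_isColoring_iff (k : CrossingKind) (a b : Fin 2 → X)
    (m : Port (Fin 2) (Fin 0) → X) :
    (bigonAntiparallel k left).IsColoring B.rule a b m ↔
      (m (pt 1 right) = b 0 ∧ m (pt 0 right) = b 1) ∧
      (m (pt 0 left), b 1) = B.rule k (m (pt 1 left), a 0) ∧
      (m (pt 0 left), a 1) = B.rule k (m (pt 1 left), b 0) := by
  constructor
  · rintro ⟨hb, inc, ha, harc, -, hc⟩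
    have hb0 : m (pt 1 right) = b 0 := hb 0
    have hb1 : m (pt 0 right) = b 1 := hb 1
    have ha0 : inc (pt 0 right) = a 0 := ha 0
    have ha1 : inc (pt 1 right) = a 1 := ha 1
    have h1 : inc (pt 1 left) = m (pt 0 left) :=
      harc _ List.mem_cons_self
    have h2 : inc (pt 0 left) = m (pt 1 left) :=
      harc _ (List.mem_cons_of_mem _ List.mem_cons_self)
    have hc0 : (m (pt 0 left), m (pt 0 right)) = B.rule k (inc (pt 0 left), inc (pt 0 right)) :=
      hc (0 : Fin 2)
    have hc1 : (m (pt 1 left), m (pt 1 right)) =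
      B.rule k.mirror (inc (pt 1 left), inc (pt 1 right)) := hc (1 : Fin 2)
    rw [ha0, hb1, h2] at hc0
    rw [hb0, ha1, h1, B.rule_mirror] at hc1
    exact ⟨⟨hb0, hb1⟩, hc0, hc1⟩
  · rintro ⟨⟨hb0, hb1⟩, hc0, hc1⟩
    refine ⟨Fin.forall_fin_two.2 ⟨hb0, hb1⟩,
      portLabels ![(m (pt 1 left), a 0), (m (pt 0 left), a 1)],
      Fin.forall_fin_two.2 ⟨rfl, rfl⟩, ?_, fun j => j.elim0, Fin.forall_fin_two.2 ⟨?_, ?_⟩⟩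
    · exact List.forall_mem_cons.2 ⟨rfl, List.forall_mem_singleton.2 rfl⟩
    · exact (congrArg (m (pt 0 left), ·) hb1).trans hc0
    · exact (congrArg (m (pt 1 left), ·) hb0).trans ((B.rule_mirror _ _ _).2 hc1)

theorem bigonAntiparallel_right_isColoring_iff (k : CrossingKind) (a b : Fin 2 → X)
    (m : Port (Fin 2) (Fin 0) → X) :
    (bigonAntiparallel k right).IsColoring B.rule a b m ↔
      (m (pt 1 left) = b 0 ∧ m (pt 0 left) = b 1) ∧
      (b 1, m (pt 0 right)) = B.rule k (a 0, m (pt 1 right)) ∧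
      (a 1, m (pt 0 right)) = B.rule k (b 0, m (pt 1 right)) := by
  constructor
  · rintro ⟨hb, inc, ha, harc, -, hc⟩
    have hb0 : m (pt 1 left) = b 0 := hb 0
    have hb1 : m (pt 0 left) = b 1 := hb 1
    have ha0 : inc (pt 0 left) = a 0 := ha 0
    have ha1 : inc (pt 1 left) = a 1 := ha 1
    have h1 : inc (pt 1 right) = m (pt 0 right) :=
      harc _ List.mem_cons_self
    have h2 : inc (pt 0 right) = m (pt 1 right) :=
      harc _ (List.mem_cons_of_mem _ List.mem_cons_self)
    have hc0 : (m (pt 0 left), m (pt 0 right)) = B.rule k (inc (pt 0 left), inc (pt 0 right)) :=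
      hc (0 : Fin 2)
    have hc1 : (m (pt 1 left), m (pt 1 right)) =
      B.rule k.mirror (inc (pt 1 left), inc (pt 1 right)) := hc (1 : Fin 2)
    rw [ha0, hb1, h2] at hc0
    rw [hb0, ha1, h1, B.rule_mirror] at hc1
    exact ⟨⟨hb0, hb1⟩, hc0, hc1⟩
  · rintro ⟨⟨hb0, hb1⟩, hc0, hc1⟩
    refine ⟨Fin.forall_fin_two.2 ⟨hb0, hb1⟩,
      portLabels ![(a 0, m (pt 1 right)), (a 1, m (pt 0 right))],
      Fin.forall_fin_two.2 ⟨rfl, rfl⟩, ?_, fun j => j.elim0, Fin.forall_fin_two.2 ⟨?_, ?_⟩⟩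
    · exact List.forall_mem_cons.2 ⟨rfl, List.forall_mem_singleton.2 rfl⟩
    · exact (congrArg (·, m (pt 0 right)) hb1).trans hc0
    · exact (congrArg (·, m (pt 1 right)) hb0).trans ((B.rule_mirror _ _ _).2 hc1)

/-- With the second crossing read backwards, both crossings obey the same rule with the same two
labels on the side of the bigon. One invertibility axiom then identifies the outer inputs and hence
the outer outputs; the other one finds the inner labels. -/
theorem bigonAntiparallel_realizes (k : CrossingKind) (s : Side) :
    (bigonAntiparallel k s).Realizes B.rule Eq := by
  cases s
  · refine ⟨?_, ?_, ?_, ?_⟩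
    · exact port_forall.2 (Fin.forall_fin_two.2
        ⟨⟨Or.inr ⟨_, List.mem_cons_of_mem _ List.mem_cons_self, rfl⟩, Or.inl ⟨0, rfl⟩⟩,
          Or.inr ⟨_, List.mem_cons_self, rfl⟩, Or.inl ⟨1, rfl⟩⟩)
    · intro a b m m' h h'
      replace h := (bigonAntiparallel_left_isColoring_iff ..).1 h
      replace h' := (bigonAntiparallel_left_isColoring_iff ..).1 h'
      obtain ⟨⟨h1, h2⟩, h3, -⟩ := h
      obtain ⟨⟨h1', h2'⟩, h3', -⟩ := h'
      have e := (B.rule_rightInvertible k (a 0) (b 1)).unique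
        (congrArg Prod.snd h3).symm (congrArg Prod.snd h3').symm
      rw [← e] at h3'
      exact funext (port_forall.2 (Fin.forall_fin_two.2
        ⟨⟨congrArg Prod.fst (h3.trans h3'.symm), h2.trans h2'.symm⟩, e, h1.trans h1'.symm⟩))
    · intro a b m h
      replace h := (bigonAntiparallel_left_isColoring_iff ..).1 h
      obtain ⟨-, h3, h4⟩ := h
      have e := (B.rule_leftInvertible k (m (pt 1 left)) (m (pt 0 left))).unique
        (congrArg Prod.fst h3).symm (congrArg Prod.fst h4).symm
      rw [← e] at h4
      exact funext (Fin.forall_fin_two.2 ⟨e, congrArg Prod.snd (h4.trans h3.symm)⟩)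
    · rintro a _ rfl
      -- Once `a = b`, the equations of the two crossings coincide, and `t` solves them as the left
      -- input.
      obtain ⟨t, ht, -⟩ := B.rule_rightInvertible k (a 0) (a 1)
      exact ⟨portLabels ![((B.rule k (t, a 0)).1, a 1), (t, a 0)],
        (bigonAntiparallel_left_isColoring_iff B _ _ _ _).2
          ⟨⟨rfl, rfl⟩, Prod.ext rfl ht.symm, Prod.ext rfl ht.symm⟩⟩
  · refine ⟨?_, ?_, ?_, ?_⟩
    · exact port_forall.2 (Fin.forall_fin_two.2
        ⟨⟨Or.inl ⟨0, rfl⟩, Or.inr ⟨_, List.mem_cons_of_mem _ List.mem_cons_self, rfl⟩⟩,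
          Or.inl ⟨1, rfl⟩, Or.inr ⟨_, List.mem_cons_self, rfl⟩⟩)
    · intro a b m m' h h'
      replace h := (bigonAntiparallel_right_isColoring_iff ..).1 h
      replace h' := (bigonAntiparallel_right_isColoring_iff ..).1 h'
      obtain ⟨⟨h1, h2⟩, h3, -⟩ := h
      obtain ⟨⟨h1', h2'⟩, h3', -⟩ := h'
      have e := (B.rule_leftInvertible k (a 0) (b 1)).unique
        (congrArg Prod.fst h3).symm (congrArg Prod.fst h3').symm
      rw [← e] at h3'
      exact funext (port_forall.2 (Fin.forall_fin_two.2
        ⟨⟨h2.trans h2'.symm, congrArg Prod.snd (h3.trans h3'.symm)⟩, h1.trans h1'.symm, e⟩))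
    · intro a b m h
      replace h := (bigonAntiparallel_right_isColoring_iff ..).1 h
      obtain ⟨-, h3, h4⟩ := h
      have e := (B.rule_rightInvertible k (m (pt 1 right)) (m (pt 0 right))).unique
        (congrArg Prod.snd h3).symm (congrArg Prod.snd h4).symm
      rw [← e] at h4
      exact funext (Fin.forall_fin_two.2 ⟨e, congrArg Prod.fst (h4.trans h3.symm)⟩)
    · rintro a _ rfl
      obtain ⟨t, ht, -⟩ := B.rule_leftInvertible k (a 0) (a 1)
      exact ⟨portLabels ![(a 1, (B.rule k (a 0, t)).2), (a 0, t)],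
        (bigonAntiparallel_right_isColoring_iff B _ _ _ _).2
          ⟨⟨rfl, rfl⟩, Prod.ext ht.symm rfl, Prod.ext ht.symm rfl⟩⟩

theorem forall_fin_three {Q : Fin 3 → Prop} : (∀ i, Q i) ↔ Q 0 ∧ Q 1 ∧ Q 2 := by
  rw [Fin.forall_fin_succ, Fin.forall_fin_two]
  rfl

theorem triangleA_isColoring_iff (rule : CrossingKind → X × X → X × X) (k₁₂ k₁₃ k₂₃ : CrossingKind)
    (a b : Fin 3 → X) (m : Port (Fin 3) (Fin 0) → X) :
    (triangleA k₁₂ k₁₃ k₂₃).IsColoring rule a b m ↔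
      (m (pt 2 left) = b 0 ∧ m (pt 2 right) = b 1 ∧ m (pt 1 right) = b 2) ∧
      (m (pt 0 left), m (pt 0 right)) = rule k₁₂ (a 0, a 1) ∧
      (m (pt 1 left), m (pt 1 right)) = rule k₁₃ (m (pt 0 right), a 2) ∧
      (m (pt 2 left), m (pt 2 right)) = rule k₂₃ (m (pt 0 left), m (pt 1 left)) := by
  constructor
  · rintro ⟨hb, inc, ha, harc, -, hc⟩
    have ha0 : inc (pt 0 left) = a 0 := ha 0
    have ha1 : inc (pt 0 right) = a 1 := ha 1
    have ha2 : inc (pt 1 right) = a 2 := ha 2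
    have h1 : inc (pt 1 left) = m (pt 0 right) :=
      harc _ List.mem_cons_self
    have h2 : inc (pt 2 left) = m (pt 0 left) :=
      harc _ (List.mem_cons_of_mem _ List.mem_cons_self)
    have h3 : inc (pt 2 right) = m (pt 1 left) :=
      harc _ (List.mem_cons_of_mem _ (List.mem_cons_of_mem _ List.mem_cons_self))
    refine ⟨⟨hb 0, hb 1, hb 2⟩, ?_, ?_, ?_⟩
    · rw [← ha0, ← ha1]; exact hc (0 : Fin 3)
    · rw [← h1, ← ha2]; exact hc (1 : Fin 3)
    · rw [← h2, ← h3]; exact hc (2 : Fin 3)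
  · rintro ⟨hb, hc⟩
    refine ⟨forall_fin_three.2 hb, portLabels
      ![(a 0, a 1), (m (pt 0 right), a 2), (m (pt 0 left), m (pt 1 left))],
      forall_fin_three.2 ⟨rfl, rfl, rfl⟩, ?_, fun j => j.elim0, forall_fin_three.2 hc⟩
    exact List.forall_mem_cons.2 ⟨rfl, List.forall_mem_cons.2
      ⟨rfl, List.forall_mem_singleton.2 rfl⟩⟩

theorem triangleB_isColoring_iff (rule : CrossingKind → X × X → X × X) (k₁₂ k₁₃ k₂₃ : CrossingKind)
    (a b : Fin 3 → X) (m : Port (Fin 3) (Fin 0) → X) :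
    (triangleB k₁₂ k₁₃ k₂₃).IsColoring rule a b m ↔
      (m (pt 1 left) = b 0 ∧ m (pt 2 left) = b 1 ∧ m (pt 2 right) = b 2) ∧
      (m (pt 0 left), m (pt 0 right)) = rule k₂₃ (a 1, a 2) ∧
      (m (pt 1 left), m (pt 1 right)) = rule k₁₃ (a 0, m (pt 0 left)) ∧
      (m (pt 2 left), m (pt 2 right)) = rule k₁₂ (m (pt 1 right), m (pt 0 right)) := by
  constructor
  · rintro ⟨hb, inc, ha, harc, -, hc⟩
    have ha0 : inc (pt 1 left) = a 0 := ha 0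
    have ha1 : inc (pt 0 left) = a 1 := ha 1
    have ha2 : inc (pt 0 right) = a 2 := ha 2
    have h1 : inc (pt 1 right) = m (pt 0 left) :=
      harc _ List.mem_cons_self
    have h2 : inc (pt 2 left) = m (pt 1 right) :=
      harc _ (List.mem_cons_of_mem _ List.mem_cons_self)
    have h3 : inc (pt 2 right) = m (pt 0 right) :=
      harc _ (List.mem_cons_of_mem _ (List.mem_cons_of_mem _ List.mem_cons_self))
    refine ⟨⟨hb 0, hb 1, hb 2⟩, ?_, ?_, ?_⟩
    · rw [← ha1, ← ha2]; exact hc (0 : Fin 3)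
    · rw [← ha0, ← h1]; exact hc (1 : Fin 3)
    · rw [← h2, ← h3]; exact hc (2 : Fin 3)
  · rintro ⟨hb, hc⟩
    refine ⟨forall_fin_three.2 hb, portLabels
      ![(a 1, a 2), (a 0, m (pt 0 left)), (m (pt 1 right), m (pt 0 right))],
      forall_fin_three.2 ⟨rfl, rfl, rfl⟩, ?_, fun j => j.elim0, forall_fin_three.2 hc⟩
    exact List.forall_mem_cons.2 ⟨rfl, List.forall_mem_cons.2
      ⟨rfl, List.forall_mem_singleton.2 rfl⟩⟩

/-- All strands run downwards, so the entries determine every label crossing by crossing. The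
subscripts of the kinds name strands, whereas `onFirst` and `onLast` refer to positions at the
current height. -/
theorem triangleA_realizes (rule : CrossingKind → X × X → X × X) (k₁₂ k₁₃ k₂₃ : CrossingKind) :
    (triangleA k₁₂ k₁₃ k₂₃).Realizes rule fun a b => (b 0, b 1, b 2) =
      (onFirst (rule k₂₃) ∘ onLast (rule k₁₃) ∘ onFirst (rule k₁₂)) (a 0, a 1, a 2) where
  complete := port_forall.2 (forall_fin_three.2
    ⟨⟨Or.inl ⟨0, rfl⟩, Or.inl ⟨1, rfl⟩⟩,
      ⟨Or.inr ⟨_, List.mem_cons_self, rfl⟩, Or.inl ⟨2, rfl⟩⟩,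
      Or.inr ⟨_, List.mem_cons_of_mem _ List.mem_cons_self, rfl⟩,
      Or.inr ⟨_, List.mem_cons_of_mem _ (List.mem_cons_of_mem _ List.mem_cons_self), rfl⟩⟩)
  unique := by
    intro a b m m' h h'
    replace h := (triangleA_isColoring_iff ..).1 h
    replace h' := (triangleA_isColoring_iff ..).1 h'
    obtain ⟨-, h0, h1, h2⟩ := h
    obtain ⟨-, h0', h1', h2'⟩ := h'
    obtain ⟨e1, e2⟩ := Prod.mk.inj (h0.trans h0'.symm)
    rw [← e2] at h1'
    obtain ⟨e3, e4⟩ := Prod.mk.inj (h1.trans h1'.symm)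
    rw [← e1, ← e3] at h2'
    exact funext (port_forall.2 (forall_fin_three.2
      ⟨⟨e1, e2⟩, ⟨e3, e4⟩, Prod.mk.inj (h2.trans h2'.symm)⟩))
  rel := by
    intro a b m h
    replace h := (triangleA_isColoring_iff ..).1 h
    obtain ⟨⟨hb0, hb1, hb2⟩, h0, h1, h2⟩ := h
    simp only [Function.comp, onFirst, onLast, ← h0, ← h1, ← h2, hb0, hb1, hb2]
  exists_coloring := by
    intro a b h
    obtain ⟨h0, h'⟩ := Prod.mk.inj h
    obtain ⟨h1, h2⟩ := Prod.mk.inj h'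
    let P := rule k₁₂ (a 0, a 1)
    let Q := rule k₁₃ (P.2, a 2)
    exact ⟨portLabels ![P, Q, rule k₂₃ (P.1, Q.1)],
      (triangleA_isColoring_iff _ _ _ _ _ _ _).2
        ⟨⟨h0.symm, h1.symm, h2.symm⟩, rfl, rfl, rfl⟩⟩

theorem triangleB_realizes (rule : CrossingKind → X × X → X × X) (k₁₂ k₁₃ k₂₃ : CrossingKind) :
    (triangleB k₁₂ k₁₃ k₂₃).Realizes rule fun a b => (b 0, b 1, b 2) =
      (onLast (rule k₁₂) ∘ onFirst (rule k₁₃) ∘ onLast (rule k₂₃)) (a 0, a 1, a 2) where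
  complete := port_forall.2 (forall_fin_three.2
    ⟨⟨Or.inl ⟨1, rfl⟩, Or.inl ⟨2, rfl⟩⟩,
      ⟨Or.inl ⟨0, rfl⟩, Or.inr ⟨_, List.mem_cons_self, rfl⟩⟩,
      Or.inr ⟨_, List.mem_cons_of_mem _ List.mem_cons_self, rfl⟩,
      Or.inr ⟨_, List.mem_cons_of_mem _ (List.mem_cons_of_mem _ List.mem_cons_self), rfl⟩⟩)
  unique := by
    intro a b m m' h h'
    replace h := (triangleB_isColoring_iff ..).1 h
    replace h' := (triangleB_isColoring_iff ..).1 h'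
    obtain ⟨-, h0, h1, h2⟩ := h
    obtain ⟨-, h0', h1', h2'⟩ := h'
    obtain ⟨e1, e2⟩ := Prod.mk.inj (h0.trans h0'.symm)
    rw [← e1] at h1'
    obtain ⟨e3, e4⟩ := Prod.mk.inj (h1.trans h1'.symm)
    rw [← e4, ← e2] at h2'
    exact funext (port_forall.2 (forall_fin_three.2
      ⟨⟨e1, e2⟩, ⟨e3, e4⟩, Prod.mk.inj (h2.trans h2'.symm)⟩))
  rel := by
    intro a b m h
    replace h := (triangleB_isColoring_iff ..).1 h
    obtain ⟨⟨hb0, hb1, hb2⟩, h0, h1, h2⟩ := h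
    simp only [Function.comp, onFirst, onLast, ← h0, ← h1, ← h2, hb0, hb1, hb2]
  exists_coloring := by
    intro a b h
    obtain ⟨h0, h'⟩ := Prod.mk.inj h
    obtain ⟨h1, h2⟩ := Prod.mk.inj h'
    let P := rule k₂₃ (a 1, a 2)
    let Q := rule k₁₃ (a 0, P.1)
    exact ⟨portLabels ![P, Q, rule k₁₂ (Q.2, P.2)],
      (triangleB_isColoring_iff _ _ _ _ _ _ _).2
        ⟨⟨h0.symm, h1.symm, h2.symm⟩, rfl, rfl, rfl⟩⟩

theorem triangle_realizes {rule : CrossingKind → X × X → X × X} {k₁₂ k₁₃ k₂₃ : CrossingKind}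
    (h : onFirst (rule k₂₃) ∘ onLast (rule k₁₃) ∘ onFirst (rule k₁₂) =
      onLast (rule k₁₂) ∘ onFirst (rule k₁₃) ∘ onLast (rule k₂₃)) :
    ∃ r, (triangleA k₁₂ k₁₃ k₂₃).Realizes rule r ∧ (triangleB k₁₂ k₁₃ k₂₃).Realizes rule r :=
  ⟨_, triangleA_realizes rule k₁₂ k₁₃ k₂₃, h ▸ triangleB_realizes rule k₁₂ k₁₃ k₂₃⟩

/-- The third move is the Yang–Baxter equation. In the mixed moves a virtual crossing merely
permutes labels, so both composites apply the rule of `k` to the same two labels and agree by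
definition. -/
theorem LocalMove.exists_realizes [Finite X] {n : ℕ} {T T' : Tangle n} (h : LocalMove T T') :
    ∃ r, T.Realizes B.rule r ∧ T'.Realizes B.rule r := by
  cases h with
  | first k s => exact ⟨_, strands_realizes _ _, kink_realizes B k s⟩
  | secondParallel k => exact ⟨_, strands_realizes _ _, bigonParallel_realizes B k⟩
  | secondAntiparallel k s => exact ⟨_, strands_realizes _ _, bigonAntiparallel_realizes B k s⟩
  | third => exact triangle_realizes B.yangBaxter
  | mixed₁₂ k => exact triangle_realizes rfl
  | mixed₁₃ k => exact triangle_realizes rfl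
  | mixed₂₃ k => exact triangle_realizes rfl

/-- The number of colorings by a finite biquandle is invariant under the generalized Reidemeister
moves. -/
theorem Biquandle.card_coloring_eq_of_step [Finite X] {D D' : LinkDiagram} (h : Step D D') :
    Nat.card (B.Coloring D) = Nat.card (B.Coloring D') := by
  cases h with
  | isotopy h => exact h.card_coloring_eq B.rule
  | subdivision h => exact h.card_coloring_eq B.rule
  | move T T' h K hD hD' =>
    obtain ⟨r, hr, hr'⟩ := h.exists_realizes B
    exact hr.card_coloring_eq hr' hD hD'

/-- The number of colorings of a virtual link by a finite biquandle. -/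
noncomputable def VirtualLink.colorings [Finite X] : VirtualLink → ℕ :=
  Quot.lift (fun D => Nat.card (B.Coloring D)) fun _ _ h => B.card_coloring_eq_of_step h

end LocalMoves

end VirtualLinks

/-- Both numbers may be computed from any diagrams of the virtual link `L`, not necessarily from
the same one. -/
theorem corollary3p3 {X : Type*} [Finite X] (B : VirtualBiquandle X) (L : VirtualLink)
    (D D' : LinkDiagram) (hD : D.Represents L) (hD' : D'.Represents L) :
    Nat.card (B.Coloring D) = Nat.card (B.twist.Coloring D') :=
  (B.card_coloring_eq_card_twist_coloring D).trans
    (congrArg (VirtualLink.colorings B.twist) (hD.trans hD'.symm))
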